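/- Let $n\geq 0$ be an integer and let $K$ be a field of characteristic zero. A \emph{positive root} is a pair $(i,j)$ with $n\geq i>j\geq 1$; $i$ is its row and $j$ is its column. A pair $(i,k)$ with $i\neq k$ is the \emph{sum} of two pairs if, for some $j\neq i,k$, these are $(i,j)$ and $(j,k)$, in either order. A \emph{basic subset} is a set $D$ of positive roots with at most one element in each row and in each column. A positive root $\alpha$ is \emph{$D$-singular} if $\alpha+\beta\in D$ for some positive root $\beta$; let $M(D)$ be the set of the positive roots that are neither $D$-singular nor in $D$. The permutation $w_D\in S_n$ is defined recursively: for $j=1,\ldots,n$, the value $w_D(j)$ is the greatest $i\in\{1,\ldots,n\}$ with $(i,j)\notin M(D)$ and $i\notin\{w_D(1),\ldots,w_D(j-1)\}$. Let $G=\mathrm{GL}(n,K)$, let $B\subset G$ be the subgroup of upper triangular matrices, let $N_-\subset G$ be the subgroup of lower triangular matrices with ones on the diagonal, and let $\mathfrak n_-$ be the space of strictly lower triangular $n\times n$ matrices over $K$. In the flag variety $G/B$ (considered as the set of its $K$-points, with the Zariski topology), let $\mathcal O=N_-B/B$ be the main affine neighborhood of the point $p=B$, and let $\Psi:\mathcal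 O\to\mathfrak n_-$ be the bijection determined by $g=(1+\Psi(g))B$ for $g\in\mathcal O$; it sends $p$ to the origin. For $w\in S_n$ let $\dot w$ be the permutation matrix with $\dot w e_j=e_{w(j)}$, let the Schubert variety $\mathcal X_w$ be the Zariski closure of the Schubert cell $B\dot wB/B$ in $G/B$, and let $\mathcal Y_w=\Psi(\mathcal X_w\cap\mathcal O)$. The permutation $w$ is called \emph{homogeneous} if $\mathcal Y_w$ is a cone with center at the origin, i.e. $0\in\mathcal Y_w$ and $tX\in\mathcal Y_w$ for all $t\in K$ and $X\in\mathcal Y_w$. \textbf{Theorem.} An element $w\in S_n$ is homogeneous if and only if $w=w_D$ for some basic subset $D$. -/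

import Mathlib

open scoped Pointwise

noncomputable section

namespace HomWeyl

/-! ### Roots, basic subsets and the permutation of a basic subset -/

/-- Positive roots: the pairs `(i, j)` (row `i`, column `j`) with `i > j`. -/
def posRoots (n : ℕ) : Set (Fin n × Fin n) := {a | a.2 < a.1}

/-- The root `γ = (i, k)` is the sum of the roots `α` and `β`: for some `j` different from `i`
and `k`, the two roots are `(i, j)` and `(j, k)`, in either order. -/
def IsRootSum {n : ℕ} (γ α β : Fin n × Fin n) : Prop :=
  γ.1 ≠ γ.2 ∧ ∃ j : Fin n, j ≠ γ.1 ∧ j ≠ γ.2 ∧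
    ((α = (γ.1, j) ∧ β = (j, γ.2)) ∨ (β = (γ.1, j) ∧ α = (j, γ.2)))

/-- A basic subset: a set of positive roots with at most one root in any row and any column. -/
structure IsBasic {n : ℕ} (D : Set (Fin n × Fin n)) : Prop where
  subset_posRoots : D ⊆ posRoots n
  row_unique : ∀ a ∈ D, ∀ b ∈ D, a.1 = b.1 → a = b
  col_unique : ∀ a ∈ D, ∀ b ∈ D, a.2 = b.2 → a = b

/-- `S(D)`: the positive roots `α` such that `α + β ∈ D` for some positive root `β`. -/
def singularRoots {n : ℕ} (D : Set (Fin n × Fin n)) : Set (Fin n × Fin n) :=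
  {α | α ∈ posRoots n ∧ ∃ β ∈ posRoots n, ∃ γ ∈ D, IsRootSum γ α β}

/-- `R(D)`: the positive roots that are not `D`-singular. -/
def regularRoots {n : ℕ} (D : Set (Fin n × Fin n)) : Set (Fin n × Fin n) :=
  posRoots n \ singularRoots D

/-- `M(D) = R(D) \ D`. -/
def MSet {n : ℕ} (D : Set (Fin n × Fin n)) : Set (Fin n × Fin n) :=
  regularRoots D \ D

/-- The rows `i` that are allowed as value at `j`, when the values at all `b < j` are given
by `f`: `(i, j) ∉ M(D)`, and `i` is not an earlier value. -/
def candidates {n : ℕ} (D : Set (Fin n × Fin n)) (j : Fin n)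
    (f : {b : Fin n // b < j} → Fin n) : Finset (Fin n) :=
  (Set.toFinite {i : Fin n | (i, j) ∉ MSet D ∧ ∀ b, f b ≠ i}).toFinset

theorem mem_candidates {n : ℕ} {D : Set (Fin n × Fin n)} {j : Fin n}
    {f : {b : Fin n // b < j} → Fin n} {i : Fin n} :
    i ∈ candidates D j f ↔ (i, j) ∉ MSet D ∧ ∀ b, f b ≠ i := by
  simp [candidates]

theorem candidates_nonempty {n : ℕ} (D : Set (Fin n × Fin n)) (j : Fin n)
    (f : {b : Fin n // b < j} → Fin n) : (candidates D j f).Nonempty := by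
  classical
  have hlt : (Finset.univ.image f).card < (Finset.Iic j).card := by
    refine lt_of_le_of_lt Finset.card_image_le ?_
    have h : (Finset.univ : Finset {b : Fin n // b < j}).card = (j : ℕ) := by
      rw [Finset.card_univ, Fintype.card_subtype]
      have : (Finset.univ.filter fun b : Fin n => b < j) = Finset.Iio j := by ext; simp
      rw [this, Fin.card_Iio]
    rw [h, Fin.card_Iic]
    omega
  obtain ⟨i, hi, hif⟩ := Finset.exists_mem_notMem_of_card_lt_card hlt
  refine ⟨i, mem_candidates.2 ⟨fun hM => ?_, fun b hb => hif ?_⟩⟩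
  · have h1 : j < i := hM.1.1
    exact absurd (Finset.mem_Iic.1 hi) (not_le.2 h1)
  · exact Finset.mem_image.2 ⟨b, Finset.mem_univ _, hb⟩

/-- `w_D(j)`, by recursion on `j`: the greatest `i` with `(i, j) ∉ M(D)` that is different from
`w_D(b)` for all `b < j`. -/
def wDFun {n : ℕ} (D : Set (Fin n × Fin n)) (j : Fin n) : Fin n :=
  (candidates D j (fun b => wDFun D b.1)).max' (candidates_nonempty D j _)
termination_by j
decreasing_by exact b.2

theorem wDFun_isGreatest {n : ℕ} (D : Set (Fin n × Fin n)) (j : Fin n) :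
    IsGreatest {i : Fin n | (i, j) ∉ MSet D ∧ ∀ b < j, wDFun D b ≠ i} (wDFun D j) := by
  have h := Finset.isGreatest_max' _ (candidates_nonempty D j (fun b => wDFun D b.1))
  have hs : {i : Fin n | (i, j) ∉ MSet D ∧ ∀ b < j, wDFun D b ≠ i}
      = (candidates D j (fun b => wDFun D b.1) : Set (Fin n)) := by
    ext i
    rw [Finset.mem_coe, mem_candidates]
    simp
  rw [hs, wDFun]
  exact h

theorem wDFun_injective {n : ℕ} (D : Set (Fin n × Fin n)) : Function.Injective (wDFun D) := by
  intro a b hab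
  rcases lt_trichotomy a b with h | h | h
  · exact absurd hab ((wDFun_isGreatest D b).1.2 a h)
  · exact h
  · exact absurd hab.symm ((wDFun_isGreatest D a).1.2 b h)

/-- The permutation `w_D`. -/
def wD {n : ℕ} (D : Set (Fin n × Fin n)) : Equiv.Perm (Fin n) :=
  Equiv.ofBijective (wDFun D) (Finite.injective_iff_bijective.1 (wDFun_injective D))

/-! ### The flag variety, Schubert varieties and the main affine neighborhood -/

section Flag

variable (n : ℕ) (K : Type*) [Field K]

/-- The subgroup `B` of upper triangular matrices in `GL(n, K)`. -/
def borel : Subgroup (GL (Fin n) K) where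
  carrier := {g | ∀ i j : Fin n, j < i → (g : Matrix (Fin n) (Fin n) K) i j = 0}
  one_mem' := by
    intro i j h
    simp [h.ne']
  mul_mem' := by
    intro a b ha hb
    have ha' : (a : Matrix (Fin n) (Fin n) K).BlockTriangular id := fun i j h => ha i j h
    have hb' : (b : Matrix (Fin n) (Fin n) K).BlockTriangular id := fun i j h => hb i j h
    intro i j h
    exact (ha'.mul hb') h
  inv_mem' := by
    intro a ha
    have ha' : (a : Matrix (Fin n) (Fin n) K).BlockTriangular id := fun i j h => ha i j h
    intro i j h
    rw [Matrix.coe_units_inv]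
    have : Invertible (a : Matrix (Fin n) (Fin n) K) := a.invertible
    exact (Matrix.blockTriangular_inv_of_blockTriangular ha') h

/-- The flag variety `G / B`. -/
abbrev Flag : Type _ := GL (Fin n) K ⧸ borel n K

/-- The Zariski topology on `GL(n, K)`: the topology with the basis of open sets
`{g | p(g) ≠ 0}`, for `p` a polynomial in the matrix entries. -/
@[reducible] def zariskiGL : TopologicalSpace (GL (Fin n) K) :=
  TopologicalSpace.generateFrom
    {U | ∃ p : MvPolynomial (Fin n × Fin n) K,
      U = {g : GL (Fin n) K | MvPolynomial.eval (fun a => (g : Matrix (Fin n) (Fin n) K) a.1 a.2) p ≠ 0}}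

/-- The Zariski topology on the flag variety `G / B`: the quotient topology of the Zariski
topology on `G`. -/
@[reducible] def zariskiFlag : TopologicalSpace (Flag n K) :=
  TopologicalSpace.coinduced (QuotientGroup.mk : GL (Fin n) K → Flag n K) (zariskiGL n K)

/-- The permutation matrix of `w`: it sends the basis vector `e_j` to `e_{w(j)}`. -/
def permGL {n : ℕ} (w : Equiv.Perm (Fin n)) : GL (Fin n) K where
  val := Matrix.of fun i j => if i = w j then 1 else 0
  inv := Matrix.of fun i j => if w i = j then 1 else 0
  val_inv := by
    ext i j
    simp only [Matrix.mul_apply, Matrix.of_apply, Matrix.one_apply, mul_ite, mul_one, mul_zero]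
    rw [Finset.sum_eq_single (w.symm j)]
    · simp
    · intro b _ hb
      rw [if_neg]
      rintro rfl
      simp at hb
    · simp
  inv_val := by
    ext i j
    simp [Matrix.mul_apply, Matrix.one_apply]

/-- The Schubert cell `B w B mod B`. -/
def schubertCell {n : ℕ} (w : Equiv.Perm (Fin n)) : Set (Flag n K) :=
  (QuotientGroup.mk : GL (Fin n) K → Flag n K) ''
    DoubleCoset.doubleCoset (permGL K w) (borel n K : Set (GL (Fin n) K)) (borel n K)

/-- The Schubert variety: the Zariski closure of the Schubert cell in the flag variety. -/
def schubertVariety {n : ℕ} (w : Equiv.Perm (Fin n)) : Set (Flag n K) :=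
  @closure (Flag n K) (zariskiFlag n K) (schubertCell K w)

/-- The space of strictly lower triangular matrices. -/
def nMinus : Submodule K (Matrix (Fin n) (Fin n) K) where
  carrier := {X | ∀ i j : Fin n, i ≤ j → X i j = 0}
  zero_mem' := by intro i j _; rfl
  add_mem' := by
    intro X Y hX hY i j h
    simp [hX i j h, hY i j h]
  smul_mem' := by
    intro c X hX i j h
    simp [hX i j h]

variable {n} {K}

theorem det_one_add (X : nMinus n K) : (1 + (X : Matrix (Fin n) (Fin n) K)).det = 1 := by
  rw [Matrix.det_of_isLowerTriangular]
  · refine Finset.prod_eq_one fun i _ => ?_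
    simp [X.2 i i le_rfl]
  · intro i j h
    have h' : i < j := h
    simp [h'.ne, X.2 i j h'.le]

/-- The lower unitriangular matrix `1 + X`, as an element of `GL(n, K)`. -/
def oneAdd (X : nMinus n K) : GL (Fin n) K :=
  Matrix.GeneralLinearGroup.mkOfDetNeZero (1 + (X : Matrix (Fin n) (Fin n) K))
    (by rw [det_one_add]; exact one_ne_zero)

theorem coe_oneAdd (X : nMinus n K) :
    (oneAdd X : Matrix (Fin n) (Fin n) K) = 1 + (X : Matrix (Fin n) (Fin n) K) := rfl

variable (n) (K)

/-- The lower unitriangular group `N₋`, as a subset of `GL(n, K)`. -/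
def lowerUnitriangular : Set (GL (Fin n) K) :=
  {g | ∀ i j : Fin n, i ≤ j →
    (g : Matrix (Fin n) (Fin n) K) i j = (1 : Matrix (Fin n) (Fin n) K) i j}

/-- The main affine neighborhood `N₋ B mod B` of the point `B mod B`. -/
def mainAffine : Set (Flag n K) :=
  (QuotientGroup.mk : GL (Fin n) K → Flag n K) ''
    (lowerUnitriangular n K * (borel n K : Set (GL (Fin n) K)))

variable {n} {K}

theorem mk_oneAdd_mem (X : nMinus n K) :
    (QuotientGroup.mk (oneAdd X) : Flag n K) ∈ mainAffine n K := by
  refine ⟨oneAdd X, Set.mem_mul.2 ⟨oneAdd X, ?_, 1, (borel n K).one_mem, mul_one _⟩, rfl⟩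
  intro i j h
  simp [coe_oneAdd, X.2 i j h]

/-- The parametrization `X ↦ (1 + X) mod B` of the main affine neighborhood. -/
def chart (X : nMinus n K) : mainAffine n K := ⟨QuotientGroup.mk (oneAdd X), mk_oneAdd_mem X⟩

theorem chart_injective : Function.Injective (chart : nMinus n K → mainAffine n K) := by
  intro X Y h
  have h1 : (QuotientGroup.mk (oneAdd X) : Flag n K) = QuotientGroup.mk (oneAdd Y) :=
    congrArg Subtype.val h
  have hb : (oneAdd X)⁻¹ * oneAdd Y ∈ borel n K := QuotientGroup.eq.1 h1
  set b := (oneAdd X)⁻¹ * oneAdd Y with hbdef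
  have hXb : oneAdd X * b = oneAdd Y := by simp [hbdef]
  have low : ∀ Z : nMinus n K,
      (oneAdd Z : Matrix (Fin n) (Fin n) K).BlockTriangular OrderDual.toDual := by
    intro Z i j hij
    have h' : i < j := hij
    simp [coe_oneAdd, h'.ne, Z.2 i j h'.le]
  have lowb : (b : Matrix (Fin n) (Fin n) K).BlockTriangular OrderDual.toDual := by
    have : Invertible (oneAdd X : Matrix (Fin n) (Fin n) K) := (oneAdd X).invertible
    have hinv := Matrix.blockTriangular_inv_of_blockTriangular (low X)
    rw [hbdef, Units.val_mul, Matrix.coe_units_inv]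
    exact hinv.mul (low Y)
  have hdiag : ∀ i j : Fin n, i ≠ j → (b : Matrix (Fin n) (Fin n) K) i j = 0 := by
    intro i j hij
    rcases lt_or_gt_of_ne hij with h | h
    · exact lowb h
    · exact hb i j h
  have hent : ∀ i j : Fin n, (oneAdd Y : Matrix (Fin n) (Fin n) K) i j
      = (oneAdd X : Matrix (Fin n) (Fin n) K) i j * (b : Matrix (Fin n) (Fin n) K) j j := by
    intro i j
    rw [← hXb, Units.val_mul, Matrix.mul_apply]
    refine Finset.sum_eq_single j (fun k _ hk => ?_) (by simp)
    rw [hdiag k j hk, mul_zero]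
  have hone : ∀ j : Fin n, (b : Matrix (Fin n) (Fin n) K) j j = 1 := by
    intro j
    have := hent j j
    simpa [coe_oneAdd, X.2 j j le_rfl, Y.2 j j le_rfl] using this.symm
  apply Subtype.ext
  ext i j
  have := hent i j
  rw [hone, mul_one, coe_oneAdd, coe_oneAdd, Matrix.add_apply, Matrix.add_apply] at this
  exact (add_left_cancel this).symm

theorem chart_surjective : Function.Surjective (chart : nMinus n K → mainAffine n K) := by
  rintro ⟨_, g, hg, rfl⟩
  obtain ⟨u, hu, b, hb, rfl⟩ := Set.mem_mul.1 hg
  refine ⟨⟨(u : Matrix (Fin n) (Fin n) K) - 1, fun i j h => ?_⟩, ?_⟩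
  · simp [hu i j h]
  · apply Subtype.ext
    change (QuotientGroup.mk (oneAdd _) : Flag n K) = QuotientGroup.mk (u * b)
    have h1 : oneAdd (⟨(u : Matrix (Fin n) (Fin n) K) - 1, fun i j h => by simp [hu i j h]⟩ :
        nMinus n K) = u := by
      apply Units.ext
      rw [coe_oneAdd]
      simp
    rw [h1]
    exact (QuotientGroup.mk_mul_of_mem u hb).symm

variable (n) (K)

/-- The isomorphism `Ψ` from the main affine neighborhood onto the strictly lower triangular
matrices, determined by `g = (1 + Ψ(g)) mod B`. -/
def Psi : mainAffine n K ≃ nMinus n K :=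
  (Equiv.ofBijective chart ⟨chart_injective, chart_surjective⟩).symm

theorem mk_oneAdd_Psi (g : mainAffine n K) :
    (QuotientGroup.mk (oneAdd (Psi n K g)) : Flag n K) = g.1 :=
  congrArg Subtype.val
    ((Equiv.ofBijective (chart : nMinus n K → mainAffine n K)
      ⟨chart_injective, chart_surjective⟩).apply_symm_apply g)

variable {n}

/-- The image under `Ψ` of the intersection of the Schubert variety of `w` with the main affine
neighborhood. -/
def schubertChart (w : Equiv.Perm (Fin n)) : Set (nMinus n K) :=
  Psi n K '' {g | (g : Flag n K) ∈ schubertVariety K w}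

variable {K}

/-- A cone with center at the origin in a vector space over `K`: a set that contains the origin
and is stable under multiplication by all scalars. -/
def IsConeAtOrigin {V : Type*} [AddCommGroup V] [Module K V] (Y : Set V) : Prop :=
  0 ∈ Y ∧ ∀ t : K, ∀ X ∈ Y, t • X ∈ Y

variable (K)

/-- `w` is homogeneous (over `K`). -/
def IsHomogeneous (w : Equiv.Perm (Fin n)) : Prop :=
  IsConeAtOrigin (K := K) (schubertChart K w)

end Flag

end HomWeyl

end

/-!
The permutations `w_D` are characterized by a condition on pairs of indices: there is no *bad pair*
`p ≤ q` with `w q < p` and `q < w⁻¹ p`. At a bad pair of `w_D`, the index `p` would be a larger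
candidate in column `q`; conversely, without bad pairs `w = w_D` for the set `D` of the entries of
the permutation matrix strictly below the diagonal (`exists_eq_wD_iff`). It remains to compare bad
pairs with homogeneity.

The Schubert variety of `w` is given by the conditions that the rank of `g` in the rows `≥ i` and
the columns `< j` is at most the number `r_w(i, j)` of ones of the permutation matrix there
(`mk_mem_schubertVariety_iff`). This uses the Bruhat decomposition and, for the Bruhat order,
degenerations along transpositions.

If there are no bad pairs, then for `i ≤ j` there is `m` in `[i, j]` with
`r_w(i, j) = (j - i) + r_w(m, m)`, so every rank condition follows from the ones at `(i, j)` with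
`j ≤ i`. The matrices `1 + X` and `X` agree on these corners, hence the conditions on `X` are
homogeneous (`isHomogeneous_of_noBadPair`).

Let `w` be homogeneous with a bad pair `(p, q)`, and let `g = b w c` be a lower unitriangular matrix
in `B w B`. As `g - s` satisfies the rank conditions for `s ≠ 1`, so does `w - s b⁻¹ c⁻¹`, and the
linear term in `s` of a bordered minor of the latter is, up to sign, the entry `(p, q)` of
`b⁻¹ c⁻¹`. Hence the row `λ` number `p` of `b⁻¹` and the column `κ` number `q` of `c⁻¹` are
orthogonal. The same holds for the lower unitriangular factor of `(1 + ε E_{αl}) g`, for almost all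
`ε`, and the first order term in `ε` says that the lower triangular part of `κ λ` commutes with `g`
at the position `(l, α)`. Take a nonzero entry `(l, k)`, `k ≤ l`, of `κ λ` on the diagonal
closest to the main one, with `k` as small as possible. It contradicts this for `α = k - 1`, when
the subdiagonal entry `(k, k - 1)` of `g` is not zero (`noBadPair_of_isHomogeneous`).
A matrix `g` with this property is a product of elementary matrices along a reduced word
(`exists_unitriangular_mem_bruhatCell`).
-/

open scoped Pointwise

noncomputable section

namespace HomWeyl

/-! ### Permutations without bad pairs -/

/-- No pair of indices `p ≤ q` satisfies `w q < p` and `q < w⁻¹ p`. -/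
def NoBadPair {n : ℕ} (w : Equiv.Perm (Fin n)) : Prop :=
  ∀ p q : Fin n, p ≤ q → w q < p → w.symm p ≤ q

/-- In column `q` of the recursion, every unused `p ≤ q` is a candidate. -/
theorem noBadPair_wD {n : ℕ} (D : Set (Fin n × Fin n)) : NoBadPair (wD D) := by
  intro p q hpq hlt
  by_contra! hq
  refine absurd hlt (not_lt.2 ((wDFun_isGreatest D q).2 ⟨fun hM => ?_, fun b hb hbp => ?_⟩))
  · exact absurd (show q < p from hM.1.1) (not_lt.2 hpq)
  · have : (wD D).symm p = b := (Equiv.symm_apply_eq _).2 hbp.symm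
    exact absurd hb (by rw [← this]; exact hq.not_gt)

/-- The entries of the permutation matrix of `w` strictly below the diagonal. -/
def belowDiag {n : ℕ} (w : Equiv.Perm (Fin n)) : Set (Fin n × Fin n) :=
  {a | a.1 = w a.2 ∧ a.2 < a.1}

theorem isBasic_belowDiag {n : ℕ} (w : Equiv.Perm (Fin n)) : IsBasic (belowDiag w) where
  subset_posRoots := fun _ ha => ha.2
  row_unique := by
    rintro ⟨a, b⟩ ⟨h1, -⟩ ⟨c, d⟩ ⟨h2, -⟩ h
    simp only at h1 h2 h
    subst h1 h2
    rw [w.injective h]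
  col_unique := by
    rintro ⟨a, b⟩ ⟨h1, -⟩ ⟨c, d⟩ ⟨h2, -⟩ h
    simp only at h1 h2 h
    subst h1 h2 h
    rfl

theorem wD_belowDiag {n : ℕ} {w : Equiv.Perm (Fin n)} (hw : NoBadPair w) :
    wD (belowDiag w) = w := by
  have key : ∀ j, wDFun (belowDiag w) j = w j := by
    intro j
    induction j using WellFoundedLT.induction with
    | _ j ih =>
      refine (wDFun_isGreatest (belowDiag w) j).unique ⟨⟨fun hM => ?_, fun b hb h => ?_⟩, ?_⟩
      · exact hM.2 ⟨rfl, hM.1.1⟩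
      · rw [ih b hb] at h
        exact hb.ne (w.injective h)
      · rintro i ⟨hi, hib⟩
        by_contra! hlt
        have hinv : j < w.symm i := by
          rcases lt_trichotomy (w.symm i) j with h | h | h
          · exact absurd (by rw [ih _ h]; simp) (hib _ h)
          · rw [← h] at hlt; simp at hlt
          · exact h
        rcases le_or_gt i j with hij | hij
        · exact absurd (hw i j hij hlt) (not_le.2 hinv)
        refine hi ⟨⟨hij, ?_⟩, fun h => hlt.ne' h.1⟩
        rintro ⟨-, β, hβ, ⟨a, c⟩, ⟨ha, -⟩, -, k, -, -, h | h⟩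
        · -- the element of `belowDiag w` lies in row `i`, left of column `j`
          obtain ⟨h1, rfl⟩ := h
          simp only [Prod.mk.injEq] at h1 ha
          obtain ⟨rfl, rfl⟩ := h1
          have : c < j := hβ
          rw [ha] at hinv
          simp at hinv
          exact absurd this hinv.not_gt
        · -- the element of `belowDiag w` lies in column `j`, below row `i`
          obtain ⟨rfl, h1⟩ := h
          simp only [Prod.mk.injEq] at h1 ha
          obtain ⟨rfl, rfl⟩ := h1
          have : i < a := hβ
          rw [ha] at this
          exact absurd this hlt.not_gt
  ext j
  exact congrArg Fin.val (key j)

theorem exists_eq_wD_iff {n : ℕ} (w : Equiv.Perm (Fin n)) :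
    (∃ D, IsBasic D ∧ w = wD D) ↔ NoBadPair w :=
  ⟨fun ⟨D, _, h⟩ => h ▸ noBadPair_wD D,
    fun h => ⟨belowDiag w, isBasic_belowDiag w, (wD_belowDiag h).symm⟩⟩

/-! ### The rank function of a permutation -/

/-- The number of ones of the permutation matrix of `w` in the rows `≥ i` and the columns `< j`. -/
def dotCount {n : ℕ} (w : Equiv.Perm (Fin n)) (i j : ℕ) : ℕ :=
  (Finset.univ.filter fun b : Fin n => (b : ℕ) < j ∧ i ≤ (w b : ℕ)).card

theorem dotCount_succ_col {n : ℕ} (w : Equiv.Perm (Fin n)) (i : ℕ) (q : Fin n) :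
    dotCount w i (q + 1) = dotCount w i q + if i ≤ (w q : ℕ) then 1 else 0 := by
  unfold dotCount
  split_ifs with h
  · rw [← Finset.card_insert_of_notMem (a := q) (by simp)]
    congr 1
    ext b
    simp only [Finset.mem_filter, Finset.mem_univ, true_and, Finset.mem_insert, Fin.ext_iff]
    constructor
    · rintro ⟨h1, h2⟩
      by_cases hb : (b : ℕ) = q
      · exact Or.inl hb
      · exact Or.inr ⟨by omega, h2⟩
    · rintro (hb | hb)
      · obtain rfl : b = q := Fin.ext hb
        exact ⟨by omega, h⟩
      · exact ⟨by omega, hb.2⟩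
  · rw [add_zero]
    congr 1
    ext b
    simp only [Finset.mem_filter, Finset.mem_univ, true_and]
    constructor
    · rintro ⟨h1, h2⟩
      refine ⟨lt_of_le_of_ne (by omega) fun hb => h ?_, h2⟩
      obtain rfl : b = q := Fin.ext hb
      exact h2
    · rintro ⟨h1, h2⟩
      exact ⟨by omega, h2⟩

theorem dotCount_eq_succ_row {n : ℕ} (w : Equiv.Perm (Fin n)) (p : Fin n) (j : ℕ) :
    dotCount w p j = dotCount w (p + 1) j + if (w.symm p : ℕ) < j then 1 else 0 := by
  unfold dotCount
  split_ifs with h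
  · rw [← Finset.card_insert_of_notMem (a := w.symm p) (by simp)]
    congr 1
    ext b
    simp only [Finset.mem_filter, Finset.mem_univ, true_and, Finset.mem_insert]
    rw [Equiv.eq_symm_apply, Fin.ext_iff]
    constructor
    · rintro ⟨h1, h2⟩
      by_cases hb : (w b : ℕ) = p
      · exact Or.inl hb
      · exact Or.inr ⟨h1, by omega⟩
    · rintro (hb | hb)
      · obtain rfl : w.symm p = b := (Equiv.symm_apply_eq _).2 (Fin.ext hb.symm)
        exact ⟨h, by simp⟩
      · exact ⟨hb.1, by omega⟩
  · rw [add_zero]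
    congr 1
    ext b
    simp only [Finset.mem_filter, Finset.mem_univ, true_and]
    constructor
    · rintro ⟨h1, h2⟩
      refine ⟨h1, lt_of_le_of_ne h2 fun hb => h ?_⟩
      obtain rfl : w.symm p = b := (Equiv.symm_apply_eq _).2 (Fin.ext hb)
      exact h1
    · rintro ⟨h1, h2⟩
      exact ⟨h1, by omega⟩

/-- Without bad pairs, the rank function is determined by its values on the diagonal: one of
the two ends of the interval `[i, j)` can always be peeled off. -/
theorem NoBadPair.exists_dotCount_eq {n : ℕ} {w : Equiv.Perm (Fin n)} (hw : NoBadPair w)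
    {i j : ℕ} (hij : i ≤ j) (hj : j ≤ n) :
    ∃ m, i ≤ m ∧ m ≤ j ∧ dotCount w i j = (j - i) + dotCount w m m := by
  obtain ⟨d, rfl⟩ := Nat.exists_eq_add_of_le hij
  induction d generalizing i with
  | zero => exact ⟨i, le_rfl, le_rfl, by simp⟩
  | succ d ih =>
    let q : Fin n := ⟨i + d, by omega⟩
    let p : Fin n := ⟨i, by omega⟩
    by_cases hq : i ≤ (w q : ℕ)
    · obtain ⟨m, h1, h2, h3⟩ := ih (i := i) (by omega) (by omega)
      refine ⟨m, h1, by omega, ?_⟩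
      have := dotCount_succ_col w i q
      rw [if_pos hq] at this
      simp only [q] at this
      rw [← add_assoc, this, h3]
      omega
    · have hp : (w.symm p : ℕ) < i + (d + 1) := by
        have := hw p q (Fin.le_def.2 (by simp [p, q])) (Fin.lt_def.2 (by simpa [p] using hq))
        have := Fin.le_def.1 this
        simp only [q] at this
        omega
      obtain ⟨m, h1, h2, h3⟩ := ih (i := i + 1) (by omega) (by omega)
      refine ⟨m, by omega, by omega, ?_⟩
      have := dotCount_eq_succ_row w p (i + (d + 1))
      rw [if_pos hp] at this
      simp only [p] at this
      rw [this, show i + (d + 1) = i + 1 + d by omega, h3]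
      omega

/-! ### Ranks of lower left corners of matrices -/

section Rank

variable {n : ℕ} {K : Type*} [Field K]

theorem matrix_rank_add_le {m : Type*} [Fintype m] (A B : Matrix m m K) :
    (A + B).rank ≤ A.rank + B.rank := by
  unfold Matrix.rank
  rw [Matrix.mulVecLin_add]
  refine le_trans (Submodule.finrank_mono ?_)
    (Submodule.finrank_add_le_finrank_add_finrank _ _)
  rintro _ ⟨x, rfl⟩
  exact Submodule.add_mem_sup ⟨x, rfl⟩ ⟨x, rfl⟩

/-- The coordinate projection onto the indices with a given property. -/
def coordProj (s : Fin n → Prop) [DecidablePred s] : Matrix (Fin n) (Fin n) K :=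
  Matrix.diagonal fun a => if s a then 1 else 0

theorem rank_coordProj (s : Fin n → Prop) [DecidablePred s] :
    (coordProj s : Matrix (Fin n) (Fin n) K).rank = (Finset.univ.filter s).card := by
  classical
  rw [coordProj, Matrix.rank_diagonal, Fintype.card_subtype]
  congr 1
  ext a
  simp

theorem coordProj_mul_apply (s : Fin n → Prop) [DecidablePred s] (M : Matrix (Fin n) (Fin n) K)
    (a b : Fin n) :
    ((coordProj s : Matrix (Fin n) (Fin n) K) * M) a b = if s a then M a b else 0 := by
  simp [coordProj, Matrix.diagonal_mul]

theorem mul_coordProj_apply (s : Fin n → Prop) [DecidablePred s] (M : Matrix (Fin n) (Fin n) K)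
    (a b : Fin n) :
    (M * (coordProj s : Matrix (Fin n) (Fin n) K)) a b = if s b then M a b else 0 := by
  simp [coordProj, Matrix.mul_diagonal]

variable (n K) in
/-- The projection onto the rows `≥ i`. -/
abbrev rowProj (i : ℕ) : Matrix (Fin n) (Fin n) K := coordProj fun a => i ≤ (a : ℕ)

variable (n K) in
/-- The projection onto the columns `< j`. -/
abbrev colProj (j : ℕ) : Matrix (Fin n) (Fin n) K := coordProj fun a => (a : ℕ) < j

/-- The rank of the part of `M` in the rows `≥ i` and the columns `< j`. -/
def cornerRank (M : Matrix (Fin n) (Fin n) K) (i j : ℕ) : ℕ :=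
  (rowProj n K i * M * colProj n K j).rank

theorem cornerRank_smul_le (t : K) (M : Matrix (Fin n) (Fin n) K) (i j : ℕ) :
    cornerRank (t • M) i j ≤ cornerRank M i j := by
  unfold cornerRank
  have : rowProj n K i * (t • M) * colProj n K j
      = (t • (1 : Matrix (Fin n) (Fin n) K)) * (rowProj n K i * M * colProj n K j) := by
    simp
  rw [this]
  exact Matrix.rank_mul_le_right _ _

/-- Deleting rows and columns of a corner lowers the rank by at most their number. -/
theorem cornerRank_le_add (M : Matrix (Fin n) (Fin n) K) {i m j : ℕ} (him : i ≤ m) (hmj : m ≤ j) :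
    cornerRank M i j ≤ (j - i) + cornerRank M m m := by
  have hR : rowProj n K i = coordProj (fun a => i ≤ (a : ℕ) ∧ (a : ℕ) < m) + rowProj n K m := by
    ext a b
    simp only [coordProj, Matrix.add_apply, Matrix.diagonal_apply]
    split_ifs <;> first | omega | simp
  have hC : colProj n K j = colProj n K m + coordProj (fun a => m ≤ (a : ℕ) ∧ (a : ℕ) < j) := by
    ext a b
    simp only [coordProj, Matrix.add_apply, Matrix.diagonal_apply]
    split_ifs <;> first | omega | simp
  have hcard : ∀ a b : ℕ,
      (Finset.univ.filter fun x : Fin n => a ≤ (x : ℕ) ∧ (x : ℕ) < b).card ≤ b - a := by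
    intro a b
    rw [← Nat.card_Ico]
    exact Finset.card_le_card_of_injOn Fin.val (fun x hx => by simpa using hx)
      Fin.val_injective.injOn
  unfold cornerRank
  have hsplit : rowProj n K i * M * colProj n K j
      = coordProj (fun a => i ≤ (a : ℕ) ∧ (a : ℕ) < m) * (M * colProj n K j)
        + (rowProj n K m * M * colProj n K m
          + rowProj n K m * M * coordProj (fun a => m ≤ (a : ℕ) ∧ (a : ℕ) < j)) := by
    rw [← mul_add, ← hC, ← Matrix.mul_assoc, ← add_mul, ← add_mul, ← hR]
  rw [hsplit]
  refine (matrix_rank_add_le _ _).trans ?_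
  have h1 := (Matrix.rank_mul_le_left (coordProj (fun a => i ≤ (a : ℕ) ∧ (a : ℕ) < m))
    (M * colProj n K j)).trans ((rank_coordProj _).le.trans (hcard i m))
  have h2 := matrix_rank_add_le (rowProj n K m * M * colProj n K m)
    (rowProj n K m * M * coordProj (fun a => m ≤ (a : ℕ) ∧ (a : ℕ) < j))
  have h3 := (Matrix.rank_mul_le_right (rowProj n K m * M)
    (coordProj (fun a => m ≤ (a : ℕ) ∧ (a : ℕ) < j))).trans
      ((rank_coordProj _).le.trans (hcard m j))
  omega

/-- Corner ranks do not grow under multiplication by upper triangular matrices. -/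
theorem cornerRank_mul_le {b c : GL (Fin n) K} (hb : b ∈ borel n K) (hc : c ∈ borel n K)
    (M : Matrix (Fin n) (Fin n) K) (i j : ℕ) :
    cornerRank (b.1 * M * c.1) i j ≤ cornerRank M i j := by
  have h1 : rowProj n K i * (b : Matrix (Fin n) (Fin n) K)
      = rowProj n K i * (b : Matrix (Fin n) (Fin n) K) * rowProj n K i := by
    ext x y
    rw [mul_coordProj_apply, coordProj_mul_apply]
    split_ifs with h h' <;> try rfl
    exact hb x y (Fin.lt_def.2 (by omega))
  have h2 : (c : Matrix (Fin n) (Fin n) K) * colProj n K j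
      = colProj n K j * ((c : Matrix (Fin n) (Fin n) K) * colProj n K j) := by
    ext x y
    rw [coordProj_mul_apply, mul_coordProj_apply]
    split_ifs with h h' <;> try rfl
    exact hc x y (Fin.lt_def.2 (by omega))
  unfold cornerRank
  have : rowProj n K i * (b.1 * M * c.1) * colProj n K j
      = (rowProj n K i * (b : Matrix (Fin n) (Fin n) K)) *
        ((rowProj n K i * M * colProj n K j) * ((c : Matrix (Fin n) (Fin n) K) * colProj n K j)) := by
    calc
      _ = (rowProj n K i * (b : Matrix (Fin n) (Fin n) K)) * M *
          ((c : Matrix (Fin n) (Fin n) K) * colProj n K j) := by simp only [Matrix.mul_assoc]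
      _ = (rowProj n K i * (b : Matrix (Fin n) (Fin n) K) * rowProj n K i) * M *
          (colProj n K j * ((c : Matrix (Fin n) (Fin n) K) * colProj n K j)) := by rw [← h1, ← h2]
      _ = _ := by simp only [Matrix.mul_assoc]
  rw [this]
  exact (Matrix.rank_mul_le_right _ _).trans (Matrix.rank_mul_le_left _ _)

theorem permGL_apply (w : Equiv.Perm (Fin n)) (i j : Fin n) :
    (permGL K w : Matrix (Fin n) (Fin n) K) i j = if i = w j then 1 else 0 := rfl

theorem cornerRank_permGL (w : Equiv.Perm (Fin n)) (i j : ℕ) :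
    cornerRank (permGL K w : Matrix (Fin n) (Fin n) K) i j = dotCount w i j := by
  have h : rowProj n K i * (permGL K w : Matrix (Fin n) (Fin n) K) * colProj n K j
      = (permGL K w : Matrix (Fin n) (Fin n) K)
        * coordProj (fun b => (b : ℕ) < j ∧ i ≤ (w b : ℕ)) := by
    ext a b
    rw [mul_coordProj_apply, mul_coordProj_apply, coordProj_mul_apply, permGL_apply]
    by_cases hab : a = w b
    · subst hab
      by_cases h1 : (b : ℕ) < j <;> by_cases h2 : i ≤ (w b : ℕ) <;> simp [h1, h2]
    · simp [hab]
  rw [cornerRank, h, Matrix.rank_mul_eq_right_of_isUnit_det, rank_coordProj, dotCount]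
  exact (Matrix.isUnit_iff_isUnit_det _).1 (permGL K w).isUnit

/-- The double coset `B w B`. -/
abbrev bruhatCell (K : Type*) [Field K] (w : Equiv.Perm (Fin n)) : Set (GL (Fin n) K) :=
  DoubleCoset.doubleCoset (permGL K w) (borel n K : Set (GL (Fin n) K)) (borel n K)

theorem mem_bruhatCell {w : Equiv.Perm (Fin n)} {g : GL (Fin n) K} :
    g ∈ bruhatCell K w ↔ ∃ b ∈ borel n K, ∃ c ∈ borel n K, g = b * permGL K w * c :=
  DoubleCoset.mem_doubleCoset

theorem mul_mem_bruhatCell {w : Equiv.Perm (Fin n)} {g b c : GL (Fin n) K} (hb : b ∈ borel n K)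
    (hg : g ∈ bruhatCell K w) (hc : c ∈ borel n K) : b * g * c ∈ bruhatCell K w := by
  obtain ⟨b', hb', c', hc', rfl⟩ := mem_bruhatCell.1 hg
  exact mem_bruhatCell.2 ⟨b * b', mul_mem hb hb', c' * c, mul_mem hc' hc, by simp only [mul_assoc]⟩

theorem cornerRank_mul_eq {b c : GL (Fin n) K} (hb : b ∈ borel n K) (hc : c ∈ borel n K)
    (M : Matrix (Fin n) (Fin n) K) (i j : ℕ) :
    cornerRank (b.1 * M * c.1) i j = cornerRank M i j := by
  refine le_antisymm (cornerRank_mul_le hb hc M i j) ?_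
  have h : (b⁻¹).1 * (b.1 * M * c.1) * (c⁻¹).1 = M := by
    calc (b⁻¹).1 * (b.1 * M * c.1) * (c⁻¹).1
        = ((b⁻¹ * b : GL (Fin n) K)).1 * M * ((c * c⁻¹ : GL (Fin n) K)).1 := by
          simp only [Units.val_mul, Matrix.mul_assoc]
      _ = M := by
          rw [inv_mul_cancel, mul_inv_cancel, Units.val_one, Matrix.one_mul, Matrix.mul_one]
  have := cornerRank_mul_le (inv_mem hb) (inv_mem hc) (b.1 * M * c.1) i j
  rw [h] at this
  exact this

theorem cornerRank_of_mem_bruhatCell {w : Equiv.Perm (Fin n)} {g : GL (Fin n) K}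
    (hg : g ∈ bruhatCell K w) (i j : ℕ) :
    cornerRank (g : Matrix (Fin n) (Fin n) K) i j = dotCount w i j := by
  obtain ⟨b, hb, c, hc, rfl⟩ := mem_bruhatCell.1 hg
  rw [Units.val_mul, Units.val_mul, cornerRank_mul_eq hb hc, cornerRank_permGL]

end Rank

/-! ### Elementary matrices and the Bruhat decomposition -/

section Bruhat

variable {n : ℕ} {K : Type*} [Field K]

/-- The invertible matrix `1 + N`, for a matrix `N` of square zero. -/
def oneAddSqZero (N : Matrix (Fin n) (Fin n) K) (h : N * N = 0) : GL (Fin n) K where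
  val := 1 + N
  inv := 1 - N
  val_inv := by rw [mul_sub, add_mul, mul_one, add_mul, h]; simp
  inv_val := by rw [sub_mul, mul_add, one_mul, mul_add, h]; simp

theorem oneAddSqZero_mem_borel {N : Matrix (Fin n) (Fin n) K} (h : N * N = 0)
    (hN : ∀ i j, j < i → N i j = 0) : oneAddSqZero N h ∈ borel n K := by
  intro i j hij
  change (1 + N) i j = 0
  simp [hN i j hij, hij.ne']

/-- The elementary matrix `1 + c E_{ij}`. -/
def elemGL (i j : Fin n) (h : i ≠ j) (c : K) : GL (Fin n) K :=
  oneAddSqZero (Matrix.single i j c) (Matrix.single_mul_single_of_ne _ _ _ _ h.symm _)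

theorem elemGL_val (i j : Fin n) (h : i ≠ j) (c : K) :
    (elemGL i j h c).1 = Matrix.transvection i j c := rfl

theorem elemGL_mem_borel {i j : Fin n} (h : i < j) (c : K) : elemGL i j h.ne c ∈ borel n K := by
  refine oneAddSqZero_mem_borel _ fun a b hab => ?_
  rw [Matrix.single_apply, if_neg]
  rintro ⟨rfl, rfl⟩
  exact absurd h hab.not_gt

/-- The invertible diagonal matrix with the entries `d`. -/
def diagGL (d : Fin n → K) (hd : ∀ i, d i ≠ 0) : GL (Fin n) K where
  val := Matrix.diagonal d
  inv := Matrix.diagonal fun i => (d i)⁻¹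
  val_inv := by
    rw [Matrix.diagonal_mul_diagonal, ← Matrix.diagonal_one]
    congr 1
    ext i
    exact mul_inv_cancel₀ (hd i)
  inv_val := by
    rw [Matrix.diagonal_mul_diagonal, ← Matrix.diagonal_one]
    congr 1
    ext i
    exact inv_mul_cancel₀ (hd i)

theorem diagGL_mem_borel (d : Fin n → K) (hd : ∀ i, d i ≠ 0) : diagGL d hd ∈ borel n K :=
  fun _ _ h => Matrix.diagonal_apply_ne _ h.ne'

theorem permGL_mul_apply (v : Equiv.Perm (Fin n)) (M : Matrix (Fin n) (Fin n) K) (i j : Fin n) :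
    ((permGL K v).1 * M) i j = M (v.symm i) j := by
  rw [Matrix.mul_apply, Finset.sum_eq_single (v.symm i)]
  · simp [permGL_apply]
  · intro b _ hb
    rw [permGL_apply, if_neg, zero_mul]
    rintro rfl
    simp at hb
  · simp

theorem mul_permGL_apply (v : Equiv.Perm (Fin n)) (M : Matrix (Fin n) (Fin n) K) (i j : Fin n) :
    (M * (permGL K v).1) i j = M i (v j) := by
  rw [Matrix.mul_apply, Finset.sum_eq_single (v j)]
  · simp [permGL_apply]
  · intro b _ hb
    rw [permGL_apply, if_neg hb, mul_zero]
  · simp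

theorem permGL_mul (v w : Equiv.Perm (Fin n)) :
    permGL K (v * w) = permGL K v * permGL K w := by
  ext i j
  have h : v.symm i = w j ↔ i = (v * w) j := Equiv.symm_apply_eq v
  rw [Units.val_mul, permGL_mul_apply, permGL_apply, permGL_apply]
  simp only [h]

theorem permGL_mul_elemGL (v : Equiv.Perm (Fin n)) (i j : Fin n) (h : i ≠ j) (c : K) :
    permGL K v * elemGL i j h c = elemGL (v i) (v j) (v.injective.ne h) c * permGL K v := by
  ext a b
  rw [Units.val_mul, Units.val_mul, permGL_mul_apply, mul_permGL_apply, elemGL_val, elemGL_val]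
  simp only [Matrix.transvection, Matrix.add_apply, Matrix.one_apply, Matrix.single_apply,
    Equiv.symm_apply_eq, Equiv.eq_symm_apply, v.injective.eq_iff]

theorem permGL_mul_diagGL (v : Equiv.Perm (Fin n)) (d : Fin n → K) (hd : ∀ i, d i ≠ 0) :
    permGL K v * diagGL d hd = diagGL (d ∘ v.symm) (fun _ => hd _) * permGL K v := by
  ext a b
  rw [Units.val_mul, Units.val_mul, permGL_mul_apply, mul_permGL_apply]
  simp [diagGL, Matrix.diagonal_apply, Equiv.symm_apply_eq]

/-- The Bruhat decomposition of a lower elementary matrix inside `GL₂`. -/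
theorem elemGL_lower_eq {j k : Fin n} (h : j < k) {s : K} (hs : s ≠ 0) :
    ∃ (d : Fin n → K) (hd : ∀ i, d i ≠ 0), elemGL k j h.ne' s
      = elemGL j k h.ne s⁻¹ * diagGL d hd * permGL K (Equiv.swap j k) * elemGL j k h.ne s⁻¹ := by
  refine ⟨fun i => if i = j then -s⁻¹ else if i = k then s else 1, fun i => ?_, ?_⟩
  · dsimp only
    split_ifs <;> simp [hs]
  ext a b
  simp only [Units.val_mul, elemGL_val, Matrix.mul_assoc]
  have hD : ∀ (d : Fin n → K) (hd : ∀ i, d i ≠ 0) (M : Matrix (Fin n) (Fin n) K) (a b : Fin n),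
      ((diagGL d hd).1 * M) a b = d a * M a b := fun d hd M a b => Matrix.diagonal_mul d M a b
  have hjk : j ≠ k := h.ne
  by_cases ha : a = j
  · subst ha
    rw [Matrix.transvection_mul_apply_same, hD, hD, permGL_mul_apply, permGL_mul_apply]
    by_cases hb : b = k
    · subst hb
      simp [Matrix.transvection, hjk, hjk.symm, hs]
    · by_cases hb' : b = a
      · subst hb'
        simp [Matrix.transvection, hjk, hjk.symm, hs]
      · simp [Matrix.transvection, hjk, hjk.symm,
          Ne.symm hb, Ne.symm hb']
  · rw [Matrix.transvection_mul_apply_of_ne _ _ _ _ ha, hD, permGL_mul_apply]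
    by_cases ha' : a = k
    · subst ha'
      by_cases hb : b = a
      · subst hb
        simp [Matrix.transvection, hjk, hjk.symm, hs]
      · by_cases hb' : b = j
        · subst hb'
          simp [Matrix.transvection, hjk.symm]
        · simp [Matrix.transvection, hjk.symm,
            Ne.symm hb, Ne.symm hb']
    · have hsw : (Equiv.swap j k).symm a = a := by
        rw [Equiv.symm_swap]; exact Equiv.swap_apply_of_ne_of_ne ha ha'
      rw [hsw]
      simp [Matrix.transvection, ha, ha', Ne.symm ha, Ne.symm ha']

/-- The first `k` columns of `h` are those of a monomial matrix, and the other entries in the rows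
of their nonzero entries vanish. -/
def MonomialUpTo (h : Matrix (Fin n) (Fin n) K) (k : ℕ) : Prop :=
  ∀ j : Fin n, (j : ℕ) < k →
    ∃ i, h i j ≠ 0 ∧ (∀ i', i' ≠ i → h i' j = 0) ∧ ∀ j', j' ≠ j → h i j' = 0

/-- One step of the Gauss elimination. The pivot is the lowest nonzero entry of the column, so
that only upper triangular row and column operations are used. -/
theorem MonomialUpTo.exists_succ {h : GL (Fin n) K} {k : Fin n} (hk : MonomialUpTo h.1 k) :
    ∃ b ∈ borel n K, ∃ c ∈ borel n K, MonomialUpTo (b * h * c).1 (k + 1) := by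
  classical
  have hne : (Finset.univ.filter fun i => h.1 i k ≠ 0).Nonempty := by
    by_contra hempty
    rw [Finset.not_nonempty_iff_eq_empty, Finset.filter_eq_empty_iff] at hempty
    have h0 : h.1.det = 0 :=
      Matrix.det_eq_zero_of_column_eq_zero k fun i => not_not.1 (hempty (Finset.mem_univ i))
    exact ((Matrix.isUnit_iff_isUnit_det _).1 h.isUnit).ne_zero h0
  set i := (Finset.univ.filter fun i => h.1 i k ≠ 0).max' hne with hi
  have hik : h.1 i k ≠ 0 := by
    have := Finset.max'_mem _ hne
    simpa using this
  have hmax : ∀ x, i < x → h.1 x k = 0 := by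
    intro x hx
    by_contra hx0
    exact absurd (Finset.le_max' _ x (by simpa using hx0)) (not_le.2 hx)
  -- the row operations that clear the column above the pivot
  let N : Matrix (Fin n) (Fin n) K :=
    Matrix.of fun x y => if y = i ∧ x < i then -(h.1 x k / h.1 i k) else 0
  have hN : N * N = 0 := by
    ext x y
    rw [Matrix.mul_apply]
    refine Finset.sum_eq_zero fun z _ => ?_
    simp only [N, Matrix.of_apply]
    by_cases hz : z = i
    · simp [hz]
    · simp [hz]
  have hNb : oneAddSqZero N hN ∈ borel n K := oneAddSqZero_mem_borel _ fun x y hxy => by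
    simp only [N, Matrix.of_apply]
    rw [if_neg]
    rintro ⟨rfl, h'⟩
    exact absurd h' hxy.not_gt
  set h1 : GL (Fin n) K := oneAddSqZero N hN * h with hh1
  have h1_apply : ∀ x y, h1.1 x y
      = h.1 x y - (if x < i then h.1 x k / h.1 i k else 0) * h.1 i y := by
    intro x y
    change ((1 + N) * h.1) x y = _
    rw [add_mul, one_mul, Matrix.add_apply, Matrix.mul_apply, Finset.sum_eq_single i]
    · simp only [N, Matrix.of_apply, true_and]
      split_ifs <;> ring
    · intro z _ hz
      simp [N, hz]
    · simp
  have h1i : ∀ y, h1.1 i y = h.1 i y := fun y => by simp [h1_apply]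
  have h1k : ∀ x, x ≠ i → h1.1 x k = 0 := by
    intro x hx
    rw [h1_apply]
    rcases lt_or_gt_of_ne hx with hlt | hgt
    · rw [if_pos hlt, div_mul_cancel₀ _ hik, sub_self]
    · rw [hmax x hgt, if_neg hgt.not_gt, zero_mul, sub_zero]
  -- the column operations that clear the row to the right of the pivot
  let N' : Matrix (Fin n) (Fin n) K :=
    Matrix.of fun x y => if x = k ∧ k < y then -(h.1 i y / h.1 i k) else 0
  have hN' : N' * N' = 0 := by
    ext x y
    rw [Matrix.mul_apply]
    refine Finset.sum_eq_zero fun z _ => ?_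
    simp only [N', Matrix.of_apply]
    by_cases hz : z = k
    · simp [hz]
    · simp [hz]
  have hNb' : oneAddSqZero N' hN' ∈ borel n K := oneAddSqZero_mem_borel _ fun x y hxy => by
    simp only [N', Matrix.of_apply]
    rw [if_neg]
    rintro ⟨rfl, h'⟩
    exact absurd h' hxy.not_gt
  set h2 : GL (Fin n) K := h1 * oneAddSqZero N' hN' with hh2
  have h2_apply : ∀ x y, h2.1 x y
      = h1.1 x y - (if k < y then h.1 i y / h.1 i k else 0) * h1.1 x k := by
    intro x y
    change (h1.1 * (1 + N')) x y = _
    rw [mul_add, mul_one, Matrix.add_apply, Matrix.mul_apply, Finset.sum_eq_single k]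
    · simp only [N', Matrix.of_apply, true_and]
      split_ifs <;> ring
    · intro z _ hz
      simp [N', hz]
    · simp
  refine ⟨_, hNb, _, hNb', ?_⟩
  change MonomialUpTo h2.1 (k + 1)
  have hprev : ∀ j : Fin n, (j : ℕ) < k → h.1 i j = 0 := by
    intro j hj
    obtain ⟨r, hr, hr1, hr2⟩ := hk j hj
    refine hr1 i fun hir => hik ?_
    rw [hir]
    exact hr2 k (by rintro rfl; omega)
  intro j hj
  rcases Nat.lt_succ_iff_lt_or_eq.1 hj with hj | hj
  · obtain ⟨r, hr, hr1, hr2⟩ := hk j hj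
    have hkj : k ≠ j := by rintro rfl; omega
    have hkj' : ¬ k < j := fun h => by have := Fin.lt_def.1 h; omega
    have hri : r ≠ i := by
      rintro rfl
      exact hik (hr2 k hkj)
    have e1 : ∀ x, h2.1 x j = h.1 x j := by
      intro x
      rw [h2_apply, if_neg hkj', h1_apply, hprev j hj]
      ring
    have e2 : ∀ y, h2.1 r y = h.1 r y := by
      intro y
      rw [h2_apply, h1k r hri, h1_apply, hr2 k hkj]
      simp
    exact ⟨r, by rwa [e1], fun x hx => by rw [e1, hr1 x hx], fun y hy => by rw [e2, hr2 y hy]⟩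
  · obtain rfl : j = k := Fin.ext hj
    refine ⟨i, ?_, fun x hx => ?_, fun y hy => ?_⟩
    · rw [h2_apply, if_neg (lt_irrefl _), h1i]
      simpa using hik
    · rw [h2_apply, if_neg (lt_irrefl _), h1k x hx]
      simp
    · rw [h2_apply, h1i, h1i]
      rcases lt_or_gt_of_ne hy with hlt | hgt
      · rw [if_neg hlt.not_gt, hprev y (Fin.lt_def.1 hlt)]
        simp
      · rw [if_pos hgt, div_mul_cancel₀ _ hik, sub_self]

theorem exists_monomialUpTo (g : GL (Fin n) K) (k : ℕ) (hk : k ≤ n) :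
    ∃ b ∈ borel n K, ∃ c ∈ borel n K, MonomialUpTo (b * g * c).1 k := by
  induction k with
  | zero => exact ⟨1, one_mem _, 1, one_mem _, fun j hj => by omega⟩
  | succ k ih =>
    obtain ⟨b, hb, c, hc, h⟩ := ih (by omega)
    obtain ⟨b', hb', c', hc', h'⟩ := MonomialUpTo.exists_succ (k := ⟨k, by omega⟩) h
    refine ⟨b' * b, mul_mem hb' hb, c * c', mul_mem hc hc', ?_⟩
    have : b' * b * g * (c * c') = b' * (b * g * c) * c' := by simp only [mul_assoc]
    rw [this]
    exact h'

/-- The Bruhat decomposition. -/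
theorem exists_mem_bruhatCell (g : GL (Fin n) K) : ∃ v, g ∈ bruhatCell K v := by
  obtain ⟨b, hb, c, hc, h⟩ := exists_monomialUpTo g n le_rfl
  choose f hf hf1 hf2 using fun j : Fin n => h j j.2
  have hinj : Function.Injective f := by
    intro x y hxy
    by_contra hne
    apply hf x
    rw [hxy]
    exact hf2 y x hne
  let v : Equiv.Perm (Fin n) := Equiv.ofBijective f (Finite.injective_iff_bijective.1 hinj)
  have key : b * g * c = permGL K v * diagGL (fun j => (b * g * c).1 (f j) j) hf := by
    ext x y
    rw [Units.val_mul (permGL K v),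
      show (diagGL (fun j => (b * g * c).1 (f j) j) hf).1
        = Matrix.diagonal (fun j => (b * g * c).1 (f j) j) from rfl,
      Matrix.mul_diagonal, permGL_apply]
    by_cases hx : x = v y
    · subst hx
      simp [v]
    · rw [if_neg hx, zero_mul]
      exact hf1 y x hx
  refine ⟨v, mem_bruhatCell.2 ⟨b⁻¹, inv_mem hb, diagGL _ hf * c⁻¹,
    mul_mem (diagGL_mem_borel _ _) (inv_mem hc), ?_⟩⟩
  rw [mul_assoc, ← mul_assoc (permGL K v), ← key]
  group

end Bruhat

/-! ### The Bruhat order in terms of rank functions -/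

section BruhatOrder

variable {n : ℕ}

theorem sum_swap (F : Fin n → Fin n → ℕ) (v : Equiv.Perm (Fin n)) {j k : Fin n} (h : j ≠ k) :
    ∑ b, F b ((v * Equiv.swap j k) b) + (F j (v j) + F k (v k))
      = ∑ b, F b (v b) + (F j (v k) + F k (v j)) := by
  have split : ∀ f : Fin n → ℕ,
      ∑ b, f b = f j + (f k + ∑ b ∈ (Finset.univ.erase j).erase k, f b) := by
    intro f
    rw [Finset.add_sum_erase _ f (by simp [h.symm]), Finset.add_sum_erase _ f (by simp)]
  have hrest : ∑ b ∈ (Finset.univ.erase j).erase k, F b ((v * Equiv.swap j k) b)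
      = ∑ b ∈ (Finset.univ.erase j).erase k, F b (v b) := by
    refine Finset.sum_congr rfl fun b hb => ?_
    simp only [Finset.mem_erase, Finset.mem_univ, and_true] at hb
    rw [Equiv.Perm.mul_apply, Equiv.swap_apply_of_ne_of_ne hb.2 hb.1]
  rw [split fun b => F b ((v * Equiv.swap j k) b), split fun b => F b (v b), hrest]
  simp only [Equiv.Perm.mul_apply, Equiv.swap_apply_left, Equiv.swap_apply_right]
  omega

theorem dotCount_eq_sum (w : Equiv.Perm (Fin n)) (i l : ℕ) :
    dotCount w i l = ∑ b : Fin n, if (b : ℕ) < l ∧ i ≤ (w b : ℕ) then 1 else 0 :=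
  Finset.card_filter _ _

/-- If the rank function of `v ≠ w` is bounded by that of `w`, then it stays so after a suitable
transposition that makes `v` longer: `j` is the first column where `v` and `w` differ, and `k` is
the first column after `j` with `v j < v k ≤ w j`. -/
theorem exists_swap_le {v w : Equiv.Perm (Fin n)} (hle : ∀ i l, dotCount v i l ≤ dotCount w i l)
    (hne : v ≠ w) : ∃ j k, j < k ∧ v j < v k ∧
      ∀ i l, dotCount (v * Equiv.swap j k) i l ≤ dotCount w i l := by
  classical
  obtain ⟨j, hj, hjmin⟩ : ∃ j, v j ≠ w j ∧ ∀ b < j, v b = w b := by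
    have hex : (Finset.univ.filter fun b => v b ≠ w b).Nonempty := by
      by_contra h
      rw [Finset.not_nonempty_iff_eq_empty, Finset.filter_eq_empty_iff] at h
      exact hne (Equiv.ext fun b => not_not.1 (h (Finset.mem_univ b)))
    refine ⟨_, (Finset.mem_filter.1 (Finset.min'_mem _ hex)).2, fun b hb => ?_⟩
    by_contra hb'
    exact absurd (Finset.min'_le _ b (by simpa using hb')) (not_le.2 hb)
  have hvw : v j < w j := by
    refine lt_of_le_of_ne (not_lt.1 fun hlt => ?_) hj
    have h1 := hle (v j) (j + 1)
    rw [dotCount_succ_col, dotCount_succ_col, if_pos le_rfl,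
      if_neg (not_le.2 (Fin.lt_def.1 hlt))] at h1
    have h2 : dotCount v (v j) j = dotCount w (v j) j := by
      unfold dotCount
      congr 1
      ext b
      simp only [Finset.mem_filter, Finset.mem_univ, true_and]
      exact and_congr_right fun hb => by rw [hjmin b (Fin.lt_def.2 hb)]
    omega
  obtain ⟨k, ⟨hjk, hk1, hk2⟩, hkmin⟩ :
      ∃ k, (j < k ∧ v j < v k ∧ v k ≤ w j) ∧ ∀ b, j < b → v j < v b → v b ≤ w j → k ≤ b := by
    have hex : (Finset.univ.filter fun k => j < k ∧ v j < v k ∧ v k ≤ w j).Nonempty := by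
      refine ⟨v.symm (w j), ?_⟩
      simp only [Finset.mem_filter, Finset.mem_univ, true_and, Equiv.apply_symm_apply, le_refl,
        and_true, hvw]
      rcases lt_trichotomy j (v.symm (w j)) with h | h | h
      · exact h
      · exact absurd ((Equiv.eq_symm_apply v).1 h) hj
      · have := hjmin _ h
        rw [Equiv.apply_symm_apply] at this
        exact absurd (w.injective this) h.ne'
    refine ⟨_, (Finset.mem_filter.1 (Finset.min'_mem _ hex)).2, fun b h1 h2 h3 => ?_⟩
    exact Finset.min'_le _ b (by simp [h1, h2, h3])
  refine ⟨j, k, hjk, hk1, fun i l => ?_⟩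
  have hswap := sum_swap (fun b x => if (b : ℕ) < l ∧ i ≤ (x : ℕ) then 1 else 0) v hjk.ne
  rw [← dotCount_eq_sum, ← dotCount_eq_sum] at hswap
  have hjk' := Fin.lt_def.1 hjk
  have hk1' := Fin.lt_def.1 hk1
  have hk2' := Fin.le_def.1 hk2
  by_cases hcase : (j : ℕ) < l ∧ l ≤ k ∧ (v j : ℕ) < i ∧ i ≤ v k
  · -- in this rectangle the rank function of `v` is smaller than that of `w`
    obtain ⟨c1, c2, c3, c4⟩ := hcase
    have hup : dotCount (v * Equiv.swap j k) i l = dotCount v i l + 1 := by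
      rw [if_neg (by omega), if_neg (by omega), if_pos (by omega), if_neg (by omega)] at hswap
      omega
    have h1 : dotCount v i l ≤ dotCount v (w j + 1) l
        + ∑ b : Fin n, if (b : ℕ) < j ∧ i ≤ (w b : ℕ) ∧ (w b : ℕ) ≤ w j then 1 else 0 := by
      rw [dotCount_eq_sum, dotCount_eq_sum, ← Finset.sum_add_distrib]
      refine Finset.sum_le_sum fun b _ => ?_
      by_cases hb : (b : ℕ) < l ∧ i ≤ (v b : ℕ)
      · rw [if_pos hb]
        rcases lt_or_ge (w j : ℕ) (v b : ℕ) with hX | hX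
        · rw [if_pos (by omega)]
          omega
        · have hbj : b < j := by
            rcases lt_trichotomy b j with h | h | h
            · exact h
            · subst h
              omega
            · have := Fin.le_def.1 (hkmin b h (Fin.lt_def.2 (by omega)) (Fin.le_def.2 hX))
              omega
          have hvb := hjmin b hbj
          rw [hvb] at hX hb
          rw [if_neg (by rw [hvb]; omega), if_pos ⟨Fin.lt_def.1 hbj, hb.2, hX⟩]
      · rw [if_neg hb]
        exact Nat.zero_le _
    have h2 : dotCount w (w j + 1) l
        + (∑ b : Fin n, if (b : ℕ) < j ∧ i ≤ (w b : ℕ) ∧ (w b : ℕ) ≤ w j then 1 else 0) + 1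
        ≤ dotCount w i l := by
      have hone : (1 : ℕ) = ∑ b : Fin n, if b = j then 1 else 0 := by simp
      conv_lhs => rw [hone]
      rw [dotCount_eq_sum, dotCount_eq_sum, ← Finset.sum_add_distrib, ← Finset.sum_add_distrib]
      refine Finset.sum_le_sum fun b _ => ?_
      by_cases hbj : b = j
      · subst hbj
        rw [if_neg (by omega), if_neg (by omega), if_pos rfl, if_pos (by omega)]
      · rw [if_neg hbj]
        split_ifs <;> omega
    have := hle (w j + 1) l
    omega
  · refine le_trans ?_ (hle i l)
    have key : (if (j : ℕ) < l ∧ i ≤ (v k : ℕ) then 1 else 0)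
        + (if (k : ℕ) < l ∧ i ≤ (v j : ℕ) then 1 else 0)
        ≤ (if (j : ℕ) < l ∧ i ≤ (v j : ℕ) then 1 else 0)
        + (if (k : ℕ) < l ∧ i ≤ (v k : ℕ) then 1 else 0) := by
      split_ifs <;> omega
    omega

/-- Downward induction in the Bruhat order, along transpositions. -/
theorem bruhat_induction {w : Equiv.Perm (Fin n)} {P : Equiv.Perm (Fin n) → Prop} (hw : P w)
    (hstep : ∀ v j k, j < k → v j < v k → P (v * Equiv.swap j k) → P v)
    (v : Equiv.Perm (Fin n)) (hle : ∀ i l, dotCount v i l ≤ dotCount w i l) : P v := by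
  -- the transposition makes the sum of the products `b * v b` smaller
  induction hm : ∑ b : Fin n, (b : ℕ) * (v b : ℕ) using Nat.strong_induction_on generalizing v with
  | _ m ih =>
    by_cases hvw : v = w
    · exact hvw ▸ hw
    obtain ⟨j, k, hjk, hv, hle'⟩ := exists_swap_le hle hvw
    refine hstep v j k hjk hv (ih _ ?_ _ hle' rfl)
    have h := sum_swap (fun b x => (b : ℕ) * (x : ℕ)) v hjk.ne
    have hjk' := Fin.lt_def.1 hjk
    have hv' := Fin.lt_def.1 hv
    nlinarith

end BruhatOrder

/-! ### Schubert varieties are given by rank conditions -/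

section Closure

variable {n : ℕ} {K : Type*} [Field K]

/-- A Zariski closed set that contains a polynomial curve except for one point contains the
whole curve. -/
theorem mem_of_isClosed_of_curve [Infinite K] {F : Set (GL (Fin n) K)}
    (hF : @IsClosed _ (zariskiGL n K) F) (γ : K → GL (Fin n) K)
    (p : Fin n → Fin n → Polynomial K) (hp : ∀ s i j, (γ s).1 i j = (p i j).eval s)
    (hγ : ∀ s, s ≠ 0 → γ s ∈ F) : γ 0 ∈ F := by
  have key : ∀ U : Set (GL (Fin n) K), @IsOpen _ (zariskiGL n K) U → γ 0 ∈ U →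
      {s | γ s ∉ U}.Finite := by
    intro U hU
    induction hU with
    | basic U hU =>
      obtain ⟨q, rfl⟩ := hU
      intro h0
      let Q : Polynomial K := MvPolynomial.aeval (fun a : Fin n × Fin n => p a.1 a.2) q
      have hQ : ∀ s, Q.eval s = MvPolynomial.eval (fun a => (γ s).1 a.1 a.2) q := by
        intro s
        simp only [Q, hp]
        rw [← Polynomial.coe_evalRingHom, MvPolynomial.aeval_def, MvPolynomial.eval,
          MvPolynomial.hom_eval₂]
        congr 1
        ext x
        simp
      have hQ0 : Q ≠ 0 := by
        intro h
        apply h0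
        rw [← hQ, h, Polynomial.eval_zero]
      refine (Polynomial.finite_setOfPred_isRoot hQ0).subset fun s hs => ?_
      have hs' : MvPolynomial.eval (fun a => (γ s).1 a.1 a.2) q = 0 := not_not.1 hs
      exact (hQ s).trans hs'
    | univ => intro _; simp
    | inter U V _ _ ihU ihV =>
      intro h0
      refine ((ihU h0.1).union (ihV h0.2)).subset fun s hs => ?_
      by_contra hs'
      simp only [Set.mem_union, Set.mem_ofPred_eq, not_or, not_not] at hs'
      exact hs hs'
    | sUnion S _ ih =>
      rintro ⟨U, hU, h0⟩
      exact (ih U hU h0).subset fun s hs hs' => hs ⟨U, hU, hs'⟩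
  by_contra h0
  have hfin := key Fᶜ hF.isOpen_compl h0
  have hinf : ({0}ᶜ : Set K).Infinite := (Set.finite_singleton 0).infinite_compl
  exact hinf (hfin.subset fun s hs => not_not.2 (hγ s hs))

theorem isClosed_setOf_cornerRank_le (i j r : ℕ) :
    @IsClosed _ (zariskiGL n K) {g : GL (Fin n) K | cornerRank g.1 i j ≤ r} := by
  let _ := zariskiGL n K
  rw [← isOpen_compl_iff, isOpen_iff_forall_mem_open]
  intro g hg
  have hg' : r < (rowProj n K i * g.1 * colProj n K j).rank := not_le.1 hg
  obtain ⟨V, U, e, -, -, hVU⟩ :=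
    Matrix.exists_rank_normal_form (rowProj n K i * g.1 * colProj n K j)
  generalize (rowProj n K i * g.1 * colProj n K j).rank = k at *
  let f : Fin k → Fin n := fun x => e.symm (Sum.inl x)
  -- the minor of size `k` that is nonzero at `g`, as a polynomial in the matrix entries
  let X : Matrix (Fin n) (Fin n) (MvPolynomial (Fin n × Fin n) K) :=
    Matrix.of fun a b => MvPolynomial.X (a, b)
  let C : Matrix (Fin n) (Fin n) K → Matrix (Fin n) (Fin n) (MvPolynomial (Fin n × Fin n) K) :=
    fun A => A.map MvPolynomial.C
  let P := ((C V * (C (rowProj n K i) * X * C (colProj n K j)) * C U).submatrix f f).det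
  have hP : ∀ h : GL (Fin n) K, MvPolynomial.eval (fun a => h.1 a.1 a.2) P
      = ((V * (rowProj n K i * h.1 * colProj n K j) * U).submatrix f f).det := by
    intro h
    have hC : ∀ A, (C A).map (MvPolynomial.eval fun a => h.1 a.1 a.2) = A := by
      intro A
      ext a b
      simp [C]
    have hX : X.map (MvPolynomial.eval fun a => h.1 a.1 a.2) = h.1 := by
      ext a b
      simp [X]
    rw [RingHom.map_det, RingHom.mapMatrix_apply, ← Matrix.submatrix_map]
    simp only [Matrix.map_mul, hC, hX]
  refine ⟨{h | MvPolynomial.eval (fun a => h.1 a.1 a.2) P ≠ 0}, fun h hh => ?_,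
    TopologicalSpace.isOpen_generateFrom_of_mem ⟨P, rfl⟩, ?_⟩
  · intro hr
    apply hh
    rw [hP]
    by_contra hdet
    have h1 := Matrix.rank_of_det_ne_zero hdet
    have h2 := Matrix.rank_submatrix_le (V * (rowProj n K i * h.1 * colProj n K j) * U) f f
    have h3 : (V * (rowProj n K i * h.1 * colProj n K j) * U).rank ≤ r :=
      ((Matrix.rank_mul_le_left _ _).trans (Matrix.rank_mul_le_right _ _)).trans hr
    rw [Fintype.card_fin] at h1
    omega
  · change MvPolynomial.eval (fun a => g.1 a.1 a.2) P ≠ 0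
    rw [hP, hVU, Matrix.submatrix_submatrix]
    have : (Matrix.fromBlocks (1 : Matrix (Fin k) (Fin k) K) 0 0
        (0 : Matrix (Fin (Fintype.card (Fin n) - k)) (Fin (Fintype.card (Fin n) - k)) K)).submatrix
        (e ∘ f) (e ∘ f) = 1 := by
      ext a b
      simp [f]
    rw [this, Matrix.det_one]
    exact one_ne_zero

theorem permGL_mul_elemGL_mem_bruhatCell {v : Equiv.Perm (Fin n)} {j k : Fin n} (hjk : j < k)
    (hv : v j < v k) {s : K} (hs : s ≠ 0) :
    permGL K v * elemGL k j hjk.ne' s ∈ bruhatCell K (v * Equiv.swap j k) := by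
  obtain ⟨d, hd, h⟩ := elemGL_lower_eq hjk hs
  rw [h, mem_bruhatCell]
  refine ⟨elemGL (v j) (v k) hv.ne s⁻¹ * diagGL (d ∘ v.symm) (fun _ => hd _),
    mul_mem (elemGL_mem_borel hv _) (diagGL_mem_borel _ _), elemGL j k hjk.ne s⁻¹,
    elemGL_mem_borel hjk _, ?_⟩
  rw [permGL_mul, ← mul_assoc, ← mul_assoc, ← mul_assoc, permGL_mul_elemGL,
    mul_assoc (elemGL _ _ _ _), permGL_mul_diagGL]
  simp only [mul_assoc]

/-- A Schubert variety is the set of the flags that satisfy the rank conditions of its cell. -/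
theorem mk_mem_schubertVariety_iff [Infinite K] {w : Equiv.Perm (Fin n)} {g : GL (Fin n) K} :
    (QuotientGroup.mk g : Flag n K) ∈ schubertVariety K w ↔
      ∀ i j, cornerRank g.1 i j ≤ dotCount w i j := by
  let _ := zariskiGL n K
  let _ := zariskiFlag n K
  have hinv : ∀ g h : GL (Fin n) K, (QuotientGroup.mk g : Flag n K) = QuotientGroup.mk h →
      ∀ i j, cornerRank g.1 i j = cornerRank h.1 i j := by
    intro g h hgh i j
    have hb := QuotientGroup.eq.1 hgh
    have : cornerRank ((1 : GL (Fin n) K).1 * g.1 * (g⁻¹ * h).1) i j = cornerRank g.1 i j :=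
      cornerRank_mul_eq (one_mem _) hb _ _ _
    rw [Units.val_one, Matrix.one_mul, ← Units.val_mul, mul_inv_cancel_left] at this
    exact this.symm
  constructor
  · intro hg
    let S : Set (Flag n K) := {x | ∀ h : GL (Fin n) K, QuotientGroup.mk h = x →
      ∀ i j, cornerRank h.1 i j ≤ dotCount w i j}
    have hS : IsClosed S := by
      rw [isClosed_coinduced]
      have : (QuotientGroup.mk : GL (Fin n) K → Flag n K) ⁻¹' S
          = ⋂ i, ⋂ j, {h : GL (Fin n) K | cornerRank h.1 i j ≤ dotCount w i j} := by
        ext h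
        simp only [Set.mem_preimage, Set.mem_iInter]
        constructor
        · intro hh i j
          exact hh h rfl i j
        · intro hh h' hh' i j
          rw [hinv h' h hh']
          exact hh i j
      rw [this]
      exact isClosed_iInter fun i => isClosed_iInter fun j => isClosed_setOf_cornerRank_le i j _
    have hcell : schubertCell K w ⊆ S := by
      rintro _ ⟨h, hh, rfl⟩ h' hh' i j
      rw [hinv h' h hh']
      exact (cornerRank_of_mem_bruhatCell hh i j).le
    exact closure_minimal hcell hS hg g rfl
  · intro hg
    let F : Set (GL (Fin n) K) :=
      (QuotientGroup.mk : GL (Fin n) K → Flag n K) ⁻¹' schubertVariety K w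
    have hF : IsClosed F := isClosed_coinduced.1 isClosed_closure
    obtain ⟨v, hv⟩ := exists_mem_bruhatCell g
    refine bruhat_induction (P := fun v => bruhatCell K v ⊆ F) (w := w) ?_ ?_ v ?_ hv
    · exact fun h hh => subset_closure ⟨h, hh, rfl⟩
    · intro v j k hjk hvjk hP h hh
      obtain ⟨b, hb, c, hc, rfl⟩ := mem_bruhatCell.1 hh
      have hcurve := mem_of_isClosed_of_curve hF
        (fun s => b * (permGL K v * elemGL k j hjk.ne' s) * c)
        ((b.1 * (permGL K v).1).map Polynomial.C *
          (1 + Matrix.single k j Polynomial.X) * c.1.map Polynomial.C :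
            Matrix (Fin n) (Fin n) (Polynomial K)) ?_ ?_
      · have h0 : elemGL k j hjk.ne' (0 : K) = 1 := by
          apply Units.ext
          rw [elemGL_val, Matrix.transvection_zero]
          rfl
        simpa only [h0, mul_one] using hcurve
      · intro s x y
        have hmap : ∀ M : Matrix (Fin n) (Fin n) (Polynomial K),
            (M x y).eval s = (M.map (Polynomial.evalRingHom s)) x y := fun M => rfl
        have hC : ∀ A : Matrix (Fin n) (Fin n) K,
            (A.map Polynomial.C).map (Polynomial.evalRingHom s) = A := by
          intro A
          ext a b
          simp
        have hE : (1 + Matrix.single k j Polynomial.X :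
            Matrix (Fin n) (Fin n) (Polynomial K)).map (Polynomial.evalRingHom s)
            = Matrix.transvection k j s := by
          ext a b
          simp only [Matrix.transvection, Matrix.map_apply, Matrix.add_apply, Matrix.one_apply,
            Matrix.single_apply, map_add]
          split_ifs <;> simp
        rw [hmap, Matrix.map_mul, Matrix.map_mul, hC, hC, hE, Units.val_mul, Units.val_mul,
          Units.val_mul, elemGL_val]
        simp only [Matrix.mul_assoc]
      · intro s hs
        exact hP (mul_mem_bruhatCell hb (permGL_mul_elemGL_mem_bruhatCell hjk hvjk hs) hc)
    · intro i l
      rw [← cornerRank_of_mem_bruhatCell hv]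
      exact hg i l

theorem mem_schubertChart_iff [Infinite K] {w : Equiv.Perm (Fin n)} {X : nMinus n K} :
    X ∈ schubertChart K w ↔ ∀ i j, cornerRank (1 + X.1) i j ≤ dotCount w i j := by
  have h : X ∈ schubertChart K w ↔
      (QuotientGroup.mk (oneAdd X) : Flag n K) ∈ schubertVariety K w := by
    constructor
    · rintro ⟨g, hg, rfl⟩
      rw [mk_oneAdd_Psi]
      exact hg
    · intro hX
      exact ⟨chart X, hX, (Equiv.symm_apply_eq _).2 rfl⟩
  rw [h, mk_mem_schubertVariety_iff, coe_oneAdd]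

/-- Without bad pairs, the rank conditions follow from those on the corners strictly below the
diagonal, which are homogeneous. -/
theorem isHomogeneous_of_noBadPair [Infinite K] {w : Equiv.Perm (Fin n)} (hw : NoBadPair w) :
    IsHomogeneous K w := by
  have hone : ∀ (X : Matrix (Fin n) (Fin n) K) (i j : ℕ), j ≤ i →
      rowProj n K i * (1 + X) * colProj n K j = rowProj n K i * X * colProj n K j := by
    intro X i j hij
    ext a b
    rw [mul_coordProj_apply, mul_coordProj_apply, coordProj_mul_apply, coordProj_mul_apply]
    split_ifs with h1 h2 <;> try rfl
    rw [Matrix.add_apply, Matrix.one_apply_ne (by rintro rfl; omega), zero_add]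
  have key : ∀ X : Matrix (Fin n) (Fin n) K,
      (∀ i j, j ≤ i → cornerRank X i j ≤ dotCount w i j) →
      ∀ i j, cornerRank (1 + X) i j ≤ dotCount w i j := by
    intro X hX
    have hbelow : ∀ i j, j ≤ i → cornerRank (1 + X) i j ≤ dotCount w i j := by
      intro i j hij
      rw [cornerRank, hone X i j hij]
      exact hX i j hij
    intro i j
    rcases le_total j i with hij | hij
    · exact hbelow i j hij
    -- columns beyond the matrix do not count
    have hmin : cornerRank (1 + X) i j = cornerRank (1 + X) i (min j n) ∧
        dotCount w i j = dotCount w i (min j n) := by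
      have hlt : ∀ b : Fin n, (b : ℕ) < j ↔ (b : ℕ) < min j n := fun b => by omega
      constructor
      · have : colProj n K j = colProj n K (min j n) := by
          ext a b
          simp only [coordProj, Matrix.diagonal_apply, hlt]
        rw [cornerRank, cornerRank, this]
      · simp only [dotCount, hlt]
    rw [hmin.1, hmin.2]
    rcases le_total (min j n) i with hij' | hij'
    · exact hbelow i _ hij'
    obtain ⟨m, h1, h2, h3⟩ := hw.exists_dotCount_eq hij' (min_le_right _ _)
    rw [h3]
    exact (cornerRank_le_add _ h1 h2).trans (Nat.add_le_add_left (hbelow m m le_rfl) _)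
  refine ⟨mem_schubertChart_iff.2 (key _ fun i j _ => ?_), fun t X hX =>
    mem_schubertChart_iff.2 (key _ fun i j hij => ?_)⟩
  · simp [cornerRank]
  · refine (cornerRank_smul_le t X.1 i j).trans ?_
    rw [cornerRank, ← hone X.1 i j hij]
    exact mem_schubertChart_iff.1 hX i j

end Closure

/-! ### Unitriangular matrices in a Bruhat cell -/

section Unitriangular

variable {n : ℕ} {K : Type*} [Field K]

theorem permGL_one : permGL K (1 : Equiv.Perm (Fin n)) = 1 := by
  ext x y
  rw [permGL_apply, Equiv.Perm.one_apply, Units.val_one]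
  by_cases h : x = y
  · rw [if_pos h, h, Matrix.one_apply_eq]
  · rw [if_neg h, Matrix.one_apply_ne h]

theorem exists_descent {u : Equiv.Perm (Fin n)} (hu : u ≠ 1) :
    ∃ i i' : Fin n, (i' : ℕ) = i + 1 ∧ u i' < u i := by
  by_contra! h
  apply hu
  rcases n with _ | n
  · exact Subsingleton.elim _ _
  have hmono : StrictMono u := Fin.strictMono_iff_lt_succ.2 fun i =>
    lt_of_le_of_ne (h i.castSucc i.succ (by simp)) (u.injective.ne (Fin.castSucc_lt_succ).ne)
  have := Subsingleton.elim (hmono.orderIsoOfSurjective u u.surjective) (OrderIso.refl _)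
  ext x
  exact congrArg Fin.val (DFunLike.congr_fun this x)

theorem diag_ne_zero_of_mem_borel {b : GL (Fin n) K} (hb : b ∈ borel n K) (i : Fin n) :
    b.1 i i ≠ 0 := by
  have hdet : b.1.det ≠ 0 := ((Matrix.isUnit_iff_isUnit_det _).1 b.isUnit).ne_zero
  rw [Matrix.det_of_isUpperTriangular (fun i j h => hb i j h), Finset.prod_ne_zero_iff] at hdet
  exact hdet i (Finset.mem_univ i)

/-- Left multiplication with a lower elementary matrix of a simple root moves the cell of `w` into
the cell of `s w`, if `s w` is longer than `w`. -/
theorem elemGL_mul_mem_bruhatCell {w : Equiv.Perm (Fin n)} {i i' : Fin n}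
    (hi : (i' : ℕ) = i + 1) (hw : w.symm i < w.symm i') {g : GL (Fin n) K}
    (hg : g ∈ bruhatCell K w) :
    elemGL i' i (Fin.lt_def.2 (by omega : (i : ℕ) < i')).ne' 1 * g
      ∈ bruhatCell K (Equiv.swap i i' * w) := by
  have hlt : i < i' := Fin.lt_def.2 (by omega)
  obtain ⟨b, hb, c, hc, rfl⟩ := mem_bruhatCell.1 hg
  obtain ⟨d, hd, h⟩ := elemGL_lower_eq hlt (one_ne_zero (α := K))
  set T := elemGL i i' hlt.ne (1 : K)⁻¹ with hT
  have hTb : T ∈ borel n K := elemGL_mem_borel hlt _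
  set β := T * b with hβ
  have hβb : β ∈ borel n K := mul_mem hTb hb
  -- the upper triangular matrix `β'` stays upper triangular under conjugation by `s`
  set θ : K := β.1 i i' / β.1 i i with hθ
  set β' := β * elemGL i i' hlt.ne (-θ) with hβ'
  have hβ'b : β' ∈ borel n K := mul_mem hβb (elemGL_mem_borel hlt _)
  have hinv : elemGL i i' hlt.ne (-θ) * elemGL i i' hlt.ne θ = 1 := by
    apply Units.ext
    rw [Units.val_mul, elemGL_val, elemGL_val,
      Matrix.transvection_mul_transvection_same _ _ hlt.ne, neg_add_cancel,
      Matrix.transvection_zero, Units.val_one]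
  have hβθ : β = β' * elemGL i i' hlt.ne θ := by
    rw [hβ', mul_assoc, hinv, mul_one]
  have h0 : β'.1 i i' = 0 := by
    rw [hβ', Units.val_mul, elemGL_val, Matrix.mul_transvection_apply_same, hθ]
    have := diag_ne_zero_of_mem_borel hβb i
    field_simp
    ring
  set S := permGL K (Equiv.swap i i') with hS
  have hSS : S * S = 1 := by
    rw [hS, ← permGL_mul, Equiv.swap_mul_self, permGL_one]
  have hconj : S * β' * S ∈ borel n K := by
    intro x y hxy
    rw [Units.val_mul, Units.val_mul, hS, mul_permGL_apply, permGL_mul_apply, Equiv.symm_swap]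
    have hxy' := Fin.lt_def.1 hxy
    by_cases hx : x = i'
    · subst hx
      rw [Equiv.swap_apply_right]
      by_cases hy : y = i
      · rw [hy, Equiv.swap_apply_left]
        exact h0
      · rw [Equiv.swap_apply_of_ne_of_ne hy hxy.ne]
        have : (y : ℕ) ≠ i := fun h => hy (Fin.ext h)
        exact hβ'b _ _ (Fin.lt_def.2 (by omega))
    · have hx1 : (x : ℕ) ≠ i' := fun h => hx (Fin.ext h)
      refine hβ'b _ _ ?_
      by_cases hx' : x = i
      · subst hx'
        rw [Equiv.swap_apply_left, Equiv.swap_apply_of_ne_of_ne hxy.ne (hxy.trans hlt).ne]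
        exact hxy.trans hlt
      · rw [Equiv.swap_apply_of_ne_of_ne hx' hx]
        have hx2 : (x : ℕ) ≠ i := fun h => hx' (Fin.ext h)
        by_cases hy : y = i
        · rw [hy, Equiv.swap_apply_left]
          rw [hy] at hxy'
          exact Fin.lt_def.2 (by omega)
        · by_cases hy' : y = i'
          · rw [hy', Equiv.swap_apply_right]
            rw [hy'] at hxy
            exact hlt.trans hxy
          · rwa [Equiv.swap_apply_of_ne_of_ne hy hy']
  have hw' : elemGL i i' hlt.ne θ * permGL K w
      = permGL K w * elemGL (w.symm i) (w.symm i') hw.ne θ := by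
    rw [permGL_mul_elemGL]
    simp only [Equiv.apply_symm_apply]
  refine mem_bruhatCell.2 ⟨T * diagGL d hd * (S * β' * S),
    mul_mem (mul_mem hTb (diagGL_mem_borel _ _)) hconj,
    elemGL (w.symm i) (w.symm i') hw.ne θ * c, mul_mem (elemGL_mem_borel hw _) hc, ?_⟩
  calc elemGL i' i hlt.ne' 1 * (b * permGL K w * c)
      = T * diagGL d hd * S * β * permGL K w * c := by rw [h, hβ]; simp only [mul_assoc]
    _ = T * diagGL d hd * S * β' * (elemGL i i' hlt.ne θ * permGL K w) * c := by
        rw [hβθ]; simp only [mul_assoc]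
    _ = T * diagGL d hd * (S * β' * (S * S)) * permGL K w *
          (elemGL (w.symm i) (w.symm i') hw.ne θ * c) := by
        rw [hw', hSS, mul_one]; simp only [mul_assoc]
    _ = _ := by rw [permGL_mul]; simp only [mul_assoc, hS]

/-- Every Bruhat cell contains a lower unitriangular matrix: the product of the matrices
`1 + E_{i+1,i}` along a reduced word. Its entry `(k + 1, k)` counts the occurrences of the `k`-th
simple reflection, so it is nonzero in characteristic zero unless `w` preserves the set of the
indices `> k`. -/
theorem exists_unitriangular_mem_bruhatCell [CharZero K] (w : Equiv.Perm (Fin n)) :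
    ∃ g ∈ bruhatCell K w, g ∈ lowerUnitriangular n K ∧
      ∀ k k' : Fin n, (k' : ℕ) = k + 1 → g.1 k' k = 0 → ∀ b, k < b → k < w b := by
  suffices H : ∃ g ∈ bruhatCell K w, g ∈ lowerUnitriangular n K ∧
      ∀ k k' : Fin n, (k' : ℕ) = k + 1 →
        ∃ m : ℕ, g.1 k' k = m ∧ (m = 0 → ∀ b, k < b → k < w b) by
    obtain ⟨g, h1, h2, h3⟩ := H
    refine ⟨g, h1, h2, fun k k' hk h0 => ?_⟩
    obtain ⟨m, hm, hm'⟩ := h3 k k' hk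
    exact hm' (by rw [hm] at h0; exact_mod_cast h0)
  induction hμ : ∑ b : Fin n, (b : ℕ) * (n - (w b : ℕ)) using Nat.strong_induction_on
    generalizing w with
  | _ μ ih =>
    by_cases hw : w.symm = 1
    · obtain rfl : w = 1 := by
        rw [← Equiv.symm_symm w, hw]; rfl
      refine ⟨1, mem_bruhatCell.2 ⟨1, one_mem _, 1, one_mem _, ?_⟩, fun _ _ _ => rfl,
        fun k k' hk => ⟨0, ?_, fun _ b hb => hb⟩⟩
      · rw [permGL_one, mul_one, mul_one]
      · rw [Units.val_one, Matrix.one_apply_ne (by rintro rfl; omega), Nat.cast_zero]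
    obtain ⟨i, i', hi, hdesc⟩ := exists_descent hw
    have hlt : i < i' := Fin.lt_def.2 (by omega)
    set w' := Equiv.swap i i' * w with hw'
    have hww' : w = Equiv.swap i i' * w' := by
      rw [hw', ← mul_assoc, Equiv.swap_mul_self, one_mul]
    have hs : ∀ x, w'.symm x = w.symm (Equiv.swap i i' x) := by
      intro x
      rw [Equiv.symm_apply_eq, hw', Equiv.Perm.mul_apply, Equiv.apply_symm_apply,
        Equiv.swap_apply_self]
    have hasc : w'.symm i < w'.symm i' := by
      rw [hs, hs, Equiv.swap_apply_left, Equiv.swap_apply_right]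
      exact hdesc
    have hμ' : ∑ b : Fin n, (b : ℕ) * (n - (w' b : ℕ)) < μ := by
      have h1 : w = w' * Equiv.swap (w'.symm i) (w'.symm i') := by
        rw [Equiv.mul_swap_eq_swap_mul, Equiv.apply_symm_apply, Equiv.apply_symm_apply]
        exact hww'
      have h2 := sum_swap (fun b x => (b : ℕ) * (n - (x : ℕ))) w' hasc.ne
      rw [← h1, hμ] at h2
      simp only [Equiv.apply_symm_apply] at h2
      have h3 := Fin.lt_def.1 hasc
      obtain ⟨e, he⟩ : ∃ e, n - (i : ℕ) = e + 1 := ⟨n - i - 1, by omega⟩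
      rw [show n - (i' : ℕ) = e by omega, he] at h2
      nlinarith
    obtain ⟨g, hg, hgu, hgk⟩ := ih _ hμ' w' rfl
    have hy : ∀ x y, (elemGL i' i hlt.ne' (1 : K) * g).1 x y
        = g.1 x y + if x = i' then g.1 i y else 0 := by
      intro x y
      rw [Units.val_mul, elemGL_val]
      by_cases hx : x = i'
      · rw [hx, Matrix.transvection_mul_apply_same, if_pos rfl, one_mul]
      · rw [Matrix.transvection_mul_apply_of_ne _ _ _ _ hx, if_neg hx, add_zero]
    refine ⟨elemGL i' i hlt.ne' 1 * g, ?_, fun x y hxy => ?_, fun k k' hk => ?_⟩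
    · rw [hww']
      exact elemGL_mul_mem_bruhatCell hi hasc hg
    · rw [hy, hgu x y hxy]
      split_ifs with hx
      · subst hx
        have : i < y := lt_of_lt_of_le hlt hxy
        rw [hgu i y this.le, Matrix.one_apply_ne this.ne, add_zero]
      · rw [add_zero]
    · obtain ⟨m, hm, hm'⟩ := hgk k k' hk
      rw [hy, hm]
      by_cases hki : k' = i'
      · obtain rfl : k = i := Fin.ext (by rw [hki] at hk; omega)
        refine ⟨m + 1, ?_, fun h => by omega⟩
        rw [if_pos hki, hgu k k le_rfl, Matrix.one_apply_eq]
        push_cast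
        rfl
      · refine ⟨m, by rw [if_neg hki, add_zero], fun h b hb => ?_⟩
        have hki' : (k : ℕ) ≠ i := fun h => hki (Fin.ext (by omega))
        have h1 := Fin.lt_def.1 (hm' h b hb)
        rw [hww', Equiv.Perm.mul_apply]
        by_cases e1 : w' b = i
        · rw [e1, Equiv.swap_apply_left]
          rw [e1] at h1
          exact Fin.lt_def.2 (by omega)
        · by_cases e2 : w' b = i'
          · rw [e2, Equiv.swap_apply_right]
            rw [e2] at h1
            exact Fin.lt_def.2 (by omega)
          · rw [Equiv.swap_apply_of_ne_of_ne e1 e2]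
            exact hm' h b hb

/-! ### The linear term of a minor at a bad pair -/

/-- At a bad pair `(p, q)`, the row `p` and the column `q` of the corner of the permutation matrix
vanish. If its rank does not grow along a line, then the linear term of a bordered minor vanishes,
which is the entry `(p, q)` of the direction. -/
theorem apply_eq_zero_of_cornerRank_permGL_sub_le [Infinite K] {w : Equiv.Perm (Fin n)}
    {p q : Fin n} (h1 : w q < p) (h2 : q < w.symm p) (C : Matrix (Fin n) (Fin n) K)
    (h : ∀ s : K, s ≠ 1 → cornerRank ((permGL K w).1 - s • C) p (q + 1) ≤ dotCount w p (q + 1)) :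
    C p q = 0 := by
  classical
  let J := {j : Fin n // (j : ℕ) < q + 1 ∧ (p : ℕ) ≤ (w j : ℕ)}
  have hJ : Fintype.card J = dotCount w p (q + 1) := Fintype.card_subtype _
  let r : Unit ⊕ J → Fin n := Sum.elim (fun _ => p) fun j => w j.1
  let c : Unit ⊕ J → Fin n := Sum.elim (fun _ => q) fun j => j.1
  have hr : ∀ x, (p : ℕ) ≤ (r x : ℕ) := by
    rintro (x | j)
    · exact le_rfl
    · exact j.2.2
  have hc : ∀ x, (c x : ℕ) < q + 1 := by
    rintro (x | j)
    · exact Nat.lt_succ_self _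
    · exact j.2.1
  have hcol : ∀ x, (permGL K w).1 (r x) q = 0 := by
    intro x
    rw [permGL_apply, if_neg]
    intro hx
    have := hr x
    rw [hx] at this
    have := Fin.lt_def.1 h1
    omega
  have hdet : ∀ s : K, s ≠ 1 → (((permGL K w).1 - s • C).submatrix r c).det = 0 := by
    intro s hs
    by_contra hne
    have e1 := Matrix.rank_of_det_ne_zero hne
    have e2 : ((permGL K w).1 - s • C).submatrix r c
        = (rowProj n K p * ((permGL K w).1 - s • C) * colProj n K (q + 1)).submatrix r c := by
      ext x y
      rw [Matrix.submatrix_apply, Matrix.submatrix_apply, mul_coordProj_apply,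
        coordProj_mul_apply, if_pos (hc y), if_pos (hr x)]
    rw [e2] at e1
    have e3 := (Matrix.rank_submatrix_le
      (rowProj n K p * ((permGL K w).1 - s • C) * colProj n K (q + 1)) r c).trans (h s hs)
    rw [e1, ← hJ, Fintype.card_sum, Fintype.card_unit] at e3
    omega
  -- the bordered minor, with a factor `s` removed from the column `q`
  let A : Matrix (Unit ⊕ J) (Unit ⊕ J) (Polynomial K) := Matrix.of fun x y =>
    Sum.elim (fun _ => -Polynomial.C (C (r x) q))
      (fun j => Polynomial.C ((permGL K w).1 (r x) j.1) - Polynomial.X * Polynomial.C (C (r x) j.1))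
      y
  have hA : ∀ s : K, A.det.eval s = (A.map (Polynomial.evalRingHom s)).det := fun s =>
    RingHom.map_det (Polynomial.evalRingHom s) A
  have hAs : ∀ s : K, A.map (Polynomial.evalRingHom s) *
      Matrix.diagonal (Sum.elim (fun _ => s) fun _ => 1)
        = ((permGL K w).1 - s • C).submatrix r c := by
    intro s
    ext x (y | y)
    · rw [Matrix.mul_diagonal, Matrix.submatrix_apply, Matrix.sub_apply,
        show c (Sum.inl y) = q from rfl, hcol]
      simp only [A, Matrix.map_apply, Matrix.of_apply, Sum.elim_inl, Matrix.smul_apply,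
        smul_eq_mul, zero_sub, Polynomial.coe_evalRingHom, Polynomial.eval_neg, Polynomial.eval_C]
      ring
    · rw [Matrix.mul_diagonal, Matrix.submatrix_apply]
      simp only [A, c, Matrix.map_apply, Matrix.of_apply, Sum.elim_inr, Matrix.sub_apply,
        Matrix.smul_apply, smul_eq_mul, mul_one, Polynomial.coe_evalRingHom, Polynomial.eval_sub,
        Polynomial.eval_mul, Polynomial.eval_X, Polynomial.eval_C]
  have hzero : A.det = 0 := by
    refine Polynomial.eq_zero_of_infinite_isRoot _ ?_
    refine (Set.Finite.infinite_compl (Set.toFinite ({0, 1} : Set K))).mono fun s hs => ?_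
    simp only [Set.mem_compl_iff, Set.mem_insert_iff, Set.mem_singleton_iff, not_or] at hs
    have e := hdet s hs.2
    rw [← hAs s, Matrix.det_mul, Matrix.det_diagonal, Fintype.prod_sum_type] at e
    simp only [Sum.elim_inl, Sum.elim_inr, Finset.prod_const_one, mul_one, Finset.univ_unique,
      Finset.prod_singleton, mul_eq_zero, hs.1, or_false] at e
    exact (hA s).trans e
  have h0 := hA 0
  have hblock : A.map (Polynomial.evalRingHom 0) = Matrix.fromBlocks
      (Matrix.of fun _ _ => -C p q) 0 (Matrix.of fun j _ => -C (w j.1) q) 1 := by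
    ext (x | x) (y | y)
    · simp [A, r]
    · have : (permGL K w).1 p y.1 = 0 := by
        rw [permGL_apply, if_neg]
        intro hp
        rw [hp, Equiv.symm_apply_apply] at h2
        have := Fin.lt_def.1 h2
        have := y.2.1
        omega
      simp [A, r, this]
    · simp [A, r]
    · by_cases hxy : x = y
      · subst hxy
        simp [A, r, permGL_apply]
      · simp [A, r, permGL_apply, hxy, Subtype.ext_iff.not.1 hxy]
  rw [hzero, hblock, Matrix.det_fromBlocks_zero₁₂, Matrix.det_one, mul_one,
    Matrix.det_unique] at h0
  simpa using h0

end Unitriangular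

/-! ### Factorization of a rank one perturbation of the identity -/

section RankOne

variable {n : ℕ} {K : Type*} [Field K]

/-- The leading principal minor of size `m` of the matrix `1 + ε h zᵀ`. -/
def rankOneMinor (h z : Fin n → K) (ε : K) (m : ℕ) : K :=
  1 + ε * ∑ x : Fin n, if (x : ℕ) < m then h x * z x else 0

/-- The lower unitriangular factor of `1 + ε h zᵀ`. -/
def rankOneLower (h z : Fin n → K) (ε : K) : Matrix (Fin n) (Fin n) K :=
  1 + Matrix.of fun x y => if y < x then ε * h x * z y / rankOneMinor h z ε (y + 1) else 0

/-- The upper triangular factor of `1 + ε h zᵀ`. -/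
def rankOneUpper (h z : Fin n → K) (ε : K) : Matrix (Fin n) (Fin n) K :=
  1 + Matrix.of fun x y => if x ≤ y then ε * h x * z y / rankOneMinor h z ε x else 0

theorem sum_ite_lt_succ (f : Fin n → K) (m : Fin n) :
    (∑ x : Fin n, if (x : ℕ) < m + 1 then f x else 0)
      = (∑ x : Fin n, if (x : ℕ) < m then f x else 0) + f m := by
  have : f m = ∑ x : Fin n, if x = m then f x else 0 := by simp
  rw [this, ← Finset.sum_add_distrib]
  refine Finset.sum_congr rfl fun x _ => ?_
  rcases lt_trichotomy x m with h | h | h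
  · have := Fin.lt_def.1 h
    rw [if_pos (by omega), if_pos this, if_neg h.ne, add_zero]
  · subst h
    simp
  · have := Fin.lt_def.1 h
    rw [if_neg (by omega), if_neg (by omega), if_neg h.ne', add_zero]

theorem rankOneMinor_succ (h z : Fin n → K) (ε : K) (m : Fin n) :
    rankOneMinor h z ε (m + 1) = rankOneMinor h z ε m + ε * (h m * z m) := by
  rw [rankOneMinor, rankOneMinor, sum_ite_lt_succ]
  ring

theorem sum_telescope {h z : Fin n → K} {ε : K} (hd : ∀ m, rankOneMinor h z ε m ≠ 0) (m : ℕ)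
    (hm : m ≤ n) :
    (∑ x : Fin n, if (x : ℕ) < m then
      ε * (h x * z x) / (rankOneMinor h z ε (x + 1) * rankOneMinor h z ε x) else 0)
      = 1 - (rankOneMinor h z ε m)⁻¹ := by
  induction m with
  | zero => simp [rankOneMinor]
  | succ m ih =>
    have e := sum_ite_lt_succ (fun x : Fin n =>
      ε * (h x * z x) / (rankOneMinor h z ε (x + 1) * rankOneMinor h z ε x)) ⟨m, hm⟩
    simp only at e
    rw [e, ih (by omega)]
    have e1 := rankOneMinor_succ h z ε ⟨m, hm⟩
    simp only at e1
    have h1 := hd m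
    have h2 := hd (m + 1)
    have e2 : ε * (h ⟨m, hm⟩ * z ⟨m, hm⟩) = rankOneMinor h z ε (m + 1) - rankOneMinor h z ε m := by
      rw [e1]; ring
    rw [e2]
    field_simp
    ring

theorem rankOneLower_mul_rankOneUpper {h z : Fin n → K} {ε : K}
    (hd : ∀ m, rankOneMinor h z ε m ≠ 0) :
    rankOneLower h z ε * rankOneUpper h z ε = 1 + ε • Matrix.vecMulVec h z := by
  have expand : ∀ A B : Matrix (Fin n) (Fin n) K, (1 + A) * (1 + B) = 1 + (A + B + A * B) := by
    intro A B
    noncomm_ring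
  rw [rankOneLower, rankOneUpper, expand]
  congr 1
  ext x y
  have hmul : ∑ k : Fin n, (if k < x then ε * h x * z k / rankOneMinor h z ε (k + 1) else 0) *
      (if k ≤ y then ε * h k * z y / rankOneMinor h z ε k else 0)
      = ε * h x * z y * (1 - (rankOneMinor h z ε (min (x : ℕ) (y + 1)))⁻¹) := by
    rw [← sum_telescope hd _ ((min_le_left _ _).trans x.2.le), Finset.mul_sum]
    refine Finset.sum_congr rfl fun k _ => ?_
    by_cases hk : (k : ℕ) < min (x : ℕ) (y + 1)
    · rw [lt_min_iff] at hk
      rw [if_pos (Fin.lt_def.2 hk.1), if_pos (Fin.le_def.2 (by omega)),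
        if_pos (lt_min_iff.2 hk)]
      have h1 := hd k
      have h2 := hd (k + 1)
      field_simp
    · rw [if_neg hk, mul_zero]
      by_cases hx : k < x
      · have := Fin.lt_def.1 hx
        rw [if_neg (c := k ≤ y), mul_zero]
        intro hy
        have := Fin.le_def.1 hy
        exact hk (lt_min_iff.2 ⟨by omega, by omega⟩)
      · rw [if_neg hx, zero_mul]
  rw [Matrix.add_apply, Matrix.add_apply, Matrix.mul_apply]
  simp only [Matrix.of_apply]
  rw [hmul, Matrix.smul_apply, Matrix.vecMulVec_apply, smul_eq_mul]
  rcases lt_or_ge y x with hyx | hxy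
  · have h1 := Fin.lt_def.1 hyx
    rw [if_pos hyx, if_neg hyx.not_ge, min_eq_right (by omega)]
    have := hd (y + 1)
    field_simp
    ring
  · have h1 := Fin.le_def.1 hxy
    rw [if_neg hxy.not_gt, if_pos hxy, min_eq_left (by omega)]
    have := hd x
    field_simp
    ring

theorem mul_mem_lowerUnitriangular {g : GL (Fin n) K} {N : Matrix (Fin n) (Fin n) K}
    (hg : g ∈ lowerUnitriangular n K) (hN : ∀ i j, i ≤ j → N i j = (1 : Matrix _ _ K) i j)
    {i j : Fin n} (hij : i ≤ j) : (g.1 * N) i j = (1 : Matrix (Fin n) (Fin n) K) i j := by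
  rw [Matrix.mul_apply, Finset.sum_eq_single j]
  · rw [hg i j hij, hN j j le_rfl, Matrix.one_apply_eq, mul_one]
  · intro k _ hk
    rcases le_or_gt i k with h | h
    · rw [hg i k h]
      by_cases hik : i = k
      · subst hik
        rw [hN i j hij, Matrix.one_apply_ne hk, mul_zero]
      · rw [Matrix.one_apply_ne hik, zero_mul]
    · rw [hN k j (h.le.trans hij), Matrix.one_apply_ne hk, mul_zero]
  · simp

/-- The column `α` of the inverse of a lower unitriangular matrix. -/
theorem inv_col_of_mem_lowerUnitriangular {g : GL (Fin n) K} (hg : g ∈ lowerUnitriangular n K)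
    (α : Fin n) : (∀ x < α, (g⁻¹).1 x α = 0) ∧ (g⁻¹).1 α α = 1 ∧
      ∀ k : Fin n, (k : ℕ) = α + 1 → (g⁻¹).1 k α = -g.1 k α := by
  have hmul : ∀ x, ∑ y, g.1 x y * (g⁻¹).1 y α = (1 : Matrix (Fin n) (Fin n) K) x α := by
    intro x
    rw [← Matrix.mul_apply, ← Units.val_mul, mul_inv_cancel, Units.val_one]
  have hlt : ∀ x < α, (g⁻¹).1 x α = 0 := by
    intro x
    induction x using WellFoundedLT.induction with
    | _ x ih =>
      intro hx
      have e := hmul x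
      rw [Matrix.one_apply_ne hx.ne, Finset.sum_eq_single x] at e
      · rwa [hg x x le_rfl, Matrix.one_apply_eq, one_mul] at e
      · intro y _ hy
        rcases lt_or_gt_of_ne hy with h | h
        · rw [ih y h (h.trans hx), mul_zero]
        · rw [hg x y h.le, Matrix.one_apply_ne h.ne, zero_mul]
      · simp
  have hα : (g⁻¹).1 α α = 1 := by
    have e := hmul α
    rw [Matrix.one_apply_eq, Finset.sum_eq_single α] at e
    · rwa [hg α α le_rfl, Matrix.one_apply_eq, one_mul] at e
    · intro y _ hy
      rcases lt_or_gt_of_ne hy with h | h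
      · rw [hlt y h, mul_zero]
      · rw [hg α y h.le, Matrix.one_apply_ne h.ne, zero_mul]
    · simp
  refine ⟨hlt, hα, fun k hk => ?_⟩
  have hkα : k ≠ α := by rintro rfl; omega
  have e := hmul k
  rw [Matrix.one_apply_ne hkα, Fintype.sum_eq_add k α hkα] at e
  · rw [hg k k le_rfl, Matrix.one_apply_eq, hα, one_mul, mul_one] at e
    exact eq_neg_of_add_eq_zero_left e
  · rintro y ⟨h1, h2⟩
    rcases lt_or_gt_of_ne h2 with h | h
    · rw [hlt y h, mul_zero]
    · have h3 : k < y := lt_of_le_of_ne (Fin.le_def.2 (by have := Fin.lt_def.1 h; omega)) h1.symm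
      rw [hg k y h3.le, Matrix.one_apply_ne h3.ne, zero_mul]

end RankOne

/-! ### Homogeneous permutations have no bad pairs -/

section Converse

variable {n : ℕ} {K : Type*} [Field K]

/-- For homogeneous `w`, a lower unitriangular matrix of the cell stays in the Schubert variety
when a scalar matrix is subtracted. -/
theorem IsHomogeneous.cornerRank_sub_le [Infinite K] {w : Equiv.Perm (Fin n)}
    (hw : IsHomogeneous K w) {m : GL (Fin n) K} (hm : m ∈ bruhatCell K w)
    (hmu : m ∈ lowerUnitriangular n K) {s : K} (hs : s ≠ 1) (i j : ℕ) :
    cornerRank (m.1 - s • (1 : Matrix (Fin n) (Fin n) K)) i j ≤ dotCount w i j := by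
  let X : nMinus n K := ⟨m.1 - 1, fun i j h => by simp [hmu i j h]⟩
  have hX : X ∈ schubertChart K w := mem_schubertChart_iff.2 fun i j => by
    change cornerRank (1 + (m.1 - 1)) i j ≤ _
    rw [add_sub_cancel]
    exact (cornerRank_of_mem_bruhatCell hm i j).le
  have h1 := mem_schubertChart_iff.1 (hw.2 (1 - s)⁻¹ X hX) i j
  have hs' : (1 - s) ≠ 0 := sub_ne_zero.2 hs.symm
  have h2 : m.1 - s • (1 : Matrix (Fin n) (Fin n) K)
      = (1 - s) • (1 + (((1 - s)⁻¹ • X : nMinus n K) : Matrix (Fin n) (Fin n) K)) := by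
    change _ = (1 - s) • (1 + (1 - s)⁻¹ • (m.1 - 1))
    rw [smul_add, smul_smul, mul_inv_cancel₀ hs', one_smul, sub_smul, one_smul]
    abel
  rw [h2]
  exact (cornerRank_smul_le _ _ _ _).trans h1

/-- The orthogonality relation at a bad pair: if `a b w c = m v` with `a, b, c, v` upper
triangular and `m` lower unitriangular, then the entry `(p, q)` of `b⁻¹ a⁻¹ v c⁻¹` vanishes. -/
theorem IsHomogeneous.apply_eq_zero [Infinite K] {w : Equiv.Perm (Fin n)}
    (hw : IsHomogeneous K w) {p q : Fin n} (h1 : w q < p) (h2 : q < w.symm p)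
    {a b c v m : GL (Fin n) K} (ha : a ∈ borel n K) (hb : b ∈ borel n K) (hc : c ∈ borel n K)
    (hv : v ∈ borel n K) (hm : m ∈ lowerUnitriangular n K)
    (h : a * (b * permGL K w * c) = m * v) : ((b⁻¹ * a⁻¹).1 * v.1 * (c⁻¹).1) p q = 0 := by
  have hab : b⁻¹ * a⁻¹ ∈ borel n K := mul_mem (inv_mem hb) (inv_mem ha)
  have hvc : v * c⁻¹ ∈ borel n K := mul_mem hv (inv_mem hc)
  have hmc : m ∈ bruhatCell K w := by
    rw [show m = (a * b) * permGL K w * (c * v⁻¹) by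
      rw [eq_mul_inv_of_mul_eq h.symm]
      simp only [mul_assoc] ]
    exact mem_bruhatCell.2 ⟨_, mul_mem ha hb, _, mul_mem hc (inv_mem hv), rfl⟩
  have hw' : permGL K w = (b⁻¹ * a⁻¹) * m * (v * c⁻¹) := by
    rw [mul_assoc _ m, ← mul_assoc m, ← h]
    group
  refine apply_eq_zero_of_cornerRank_permGL_sub_le h1 h2 _ fun s hs => ?_
  have e : (permGL K w).1 - s • ((b⁻¹ * a⁻¹).1 * v.1 * (c⁻¹).1)
      = (b⁻¹ * a⁻¹).1 * (m.1 - s • (1 : Matrix (Fin n) (Fin n) K)) * (v * c⁻¹).1 := by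
    conv_lhs => rw [hw']
    simp only [Units.val_mul, Matrix.mul_sub, Matrix.sub_mul, Matrix.mul_assoc, Matrix.smul_mul,
      Matrix.mul_smul, Matrix.one_mul]
  rw [e, cornerRank_mul_eq hab hvc]
  exact hw.cornerRank_sub_le hmc hm hs _ _

end Converse

section Main

variable {n : ℕ} {K : Type*} [Field K]

/-- The row `p` of `b⁻¹` and the column `q` of `c⁻¹` at a bad pair are orthogonal. The
orthogonality for the perturbations of `b w c` by elementary upper triangular matrices is
incompatible with nonzero entries of `b w c` on the subdiagonal. -/
theorem noBadPair_of_isHomogeneous [CharZero K] {w : Equiv.Perm (Fin n)}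
    (hw : IsHomogeneous K w) : NoBadPair w := by
  classical
  intro p q hpq h1
  by_contra! h2
  obtain ⟨g, hg, hgu, hgk⟩ := exists_unitriangular_mem_bruhatCell (K := K) w
  obtain ⟨b, hb, c, hc, hbc⟩ := mem_bruhatCell.1 hg
  set lam : Fin n → K := fun k => (b⁻¹).1 p k with hlam
  set kap : Fin n → K := fun k => (c⁻¹).1 k q with hkap
  have hlam0 : ∀ k < p, lam k = 0 := fun k hk => (inv_mem hb) p k hk
  have hkap0 : ∀ k, q < k → kap k = 0 := fun k hk => (inv_mem hc) k q hk
  have hlamp : lam p ≠ 0 := diag_ne_zero_of_mem_borel (inv_mem hb) p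
  have hkapq : kap q ≠ 0 := diag_ne_zero_of_mem_borel (inv_mem hc) q
  have horth : ∑ x, lam x * kap x = 0 := by
    have := hw.apply_eq_zero h1 h2 (one_mem _) hb hc (one_mem _) hgu
      (show 1 * (b * permGL K w * c) = g * 1 by rw [one_mul, mul_one, hbc])
    rw [inv_one, mul_one, Units.val_one, mul_one, Matrix.mul_apply] at this
    exact this
  -- a pair `k ≤ l` with `lam k * kap l ≠ 0`, for which `(l - k, k)` is lexicographically minimal
  obtain ⟨⟨k, l⟩, hkl, hmin⟩ := Finset.exists_min_image
    (Finset.univ.filter fun a : Fin n × Fin n => a.1 ≤ a.2 ∧ lam a.1 * kap a.2 ≠ 0)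
    (fun a => toLex ((a.2 : ℕ) - (a.1 : ℕ), (a.1 : ℕ)))
    ⟨(p, q), by simp [hpq, hlamp, hkapq]⟩
  simp only [Finset.mem_filter, Finset.mem_univ, true_and, ne_eq, mul_eq_zero, not_or] at hkl
  obtain ⟨hkl, hlamk, hkapl⟩ := hkl
  have hmin' : ∀ x y : Fin n, x ≤ y → lam x * kap y ≠ 0 →
      (l : ℕ) - k < (y : ℕ) - x ∨ (l : ℕ) - k = (y : ℕ) - x ∧ (k : ℕ) ≤ x := by
    intro x y hxy hne
    have := hmin (x, y) (by simpa [hxy] using hne)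
    rwa [Prod.Lex.toLex_le_toLex] at this
  have hpk : p ≤ k := not_lt.1 fun h => hlamk (hlam0 k h)
  have hlq : l ≤ q := not_lt.1 fun h => hkapl (hkap0 l h)
  have hpos : 0 < (k : ℕ) := by
    have e1 := Fin.lt_def.1 h1
    have e2 := Fin.le_def.1 hpk
    omega
  obtain ⟨α, hα⟩ : ∃ α : Fin n, (k : ℕ) = α + 1 := ⟨⟨k - 1, by omega⟩, by simp; omega⟩
  have hαk : α < k := Fin.lt_def.2 (by omega)
  have hαl : α < l := hαk.trans_le hkl
  -- the subdiagonal entry does not vanish, as `w q < p ≤ k ≤ l ≤ q`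
  have hgne : g.1 k α ≠ 0 := by
    intro h0
    have e1 := Fin.lt_def.1 (hgk α k hα h0 q (hαl.trans_le hlq))
    have e2 := Fin.lt_def.1 h1
    have e3 := Fin.le_def.1 hpk
    omega
  -- `(1 + ε E_{αl}) g = g (1 + ε h zᵀ)`
  set h : Fin n → K := fun x => (g⁻¹).1 x α with hh
  set z : Fin n → K := fun y => g.1 l y with hz
  obtain ⟨hh0, hhα, hhk⟩ := inv_col_of_mem_lowerUnitriangular hgu α
  have hz0 : ∀ y, l < y → z y = 0 := by
    intro y hy
    rw [hz]
    dsimp only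
    rw [hgu l y hy.le, Matrix.one_apply_ne hy.ne]
  have hzl : z l = 1 := by
    rw [hz]
    dsimp only
    rw [hgu l l le_rfl, Matrix.one_apply_eq]
  have hfac : ∀ ε : K, (elemGL α l hαl.ne ε).1 * g.1 = g.1 * (1 + ε • Matrix.vecMulVec h z) := by
    intro ε
    have hgh : g.1 * Matrix.vecMulVec h z = Matrix.single α l 1 * g.1 := by
      have : Matrix.vecMulVec h z = (g⁻¹).1 * (Matrix.single α l 1 * g.1) := by
        ext x y
        rw [Matrix.vecMulVec_apply, Matrix.mul_apply, Finset.sum_eq_single α]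
        · simp [h, z]
        · intro m _ hm
          rw [Matrix.single_mul_apply_of_ne _ _ _ _ _ hm, mul_zero]
        · simp
      rw [this, ← Matrix.mul_assoc, ← Units.val_mul, mul_inv_cancel, Units.val_one, one_mul]
    rw [elemGL_val, Matrix.transvection, add_mul, one_mul, mul_add, mul_one, Matrix.mul_smul, hgh,
      ← Matrix.smul_mul, Matrix.smul_single, smul_eq_mul, mul_one]
  -- the orthogonality relation for the perturbed matrix
  have hrel : ∀ ε : K, ε ≠ 0 → (∀ m, rankOneMinor h z ε m ≠ 0) →
      lam k * h k * rankOneMinor h z ε l = ε * (lam α * h l) * rankOneMinor h z ε k := by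
    intro ε hε hd
    have hLU := rankOneLower_mul_rankOneUpper hd
    set V := rankOneUpper h z ε with hV
    have hdetT : ((elemGL α l hαl.ne ε).1 * g.1).det ≠ 0 :=
      ((Matrix.isUnit_iff_isUnit_det _).1 (elemGL α l hαl.ne ε * g).isUnit).ne_zero
    rw [hfac, ← hLU, ← Matrix.mul_assoc, Matrix.det_mul] at hdetT
    let v : GL (Fin n) K := Matrix.GeneralLinearGroup.mkOfDetNeZero V (right_ne_zero_of_mul hdetT)
    have hvV : v.1 = V := rfl
    have hvb : v ∈ borel n K := by
      intro i j hij
      change V i j = 0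
      simp [hV, rankOneUpper, hij.ne', hij.not_ge]
    set m : GL (Fin n) K := elemGL α l hαl.ne ε * g * v⁻¹ with hm
    have hmv : elemGL α l hαl.ne ε * g = m * v := by rw [hm, inv_mul_cancel_right]
    have hmval : m.1 = g.1 * rankOneLower h z ε := by
      have e : m.1 * v.1 = g.1 * rankOneLower h z ε * v.1 := by
        rw [← Units.val_mul, ← hmv, Units.val_mul, hfac, ← hLU, hvV, Matrix.mul_assoc]
      calc m.1 = m.1 * v.1 * (v⁻¹).1 := by
            rw [Matrix.mul_assoc, ← Units.val_mul, mul_inv_cancel, Units.val_one, mul_one]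
        _ = g.1 * rankOneLower h z ε := by
            rw [e, Matrix.mul_assoc, ← Units.val_mul, mul_inv_cancel, Units.val_one, mul_one]
    have hmu : m ∈ lowerUnitriangular n K := by
      intro i j hij
      rw [hmval]
      refine mul_mem_lowerUnitriangular hgu (fun x y hxy => ?_) hij
      simp [rankOneLower, hxy.not_gt]
    have key := hw.apply_eq_zero h1 h2 (elemGL_mem_borel hαl ε) hb hc hvb hmu
      (by rw [← hbc]; exact hmv)
    have hTinv : ((elemGL α l hαl.ne ε)⁻¹).1 = 1 - Matrix.single α l ε := rfl
    -- the three contributions to the relation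
    have hd1 : rankOneMinor h z ε α = 1 := by
      rw [rankOneMinor, Finset.sum_eq_zero, mul_zero, add_zero]
      intro x _
      split_ifs with hx
      · rw [show h x = 0 from hh0 x (Fin.lt_def.2 hx), zero_mul]
      · rfl
    have hVy : ∑ y, V l y * kap y = kap l + ε * h l / rankOneMinor h z ε l * kap l := by
      rw [Fintype.sum_eq_single l]
      · simp [hV, rankOneUpper, hzl, add_mul]
      · intro y hy
        rcases lt_or_gt_of_ne hy with hlt | hgt
        · simp [hV, rankOneUpper, hy.symm, hlt.not_ge]
        · simp [hV, rankOneUpper, hy.symm, hz0 y hgt]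
    have hVxy : ∑ x, lam x * ∑ y, V x y * kap y
        = ε * lam k * kap l * h k / rankOneMinor h z ε k + ε * lam α * kap l := by
      have e1 : ∀ x, lam x * ∑ y, V x y * kap y = lam x * kap x +
          ∑ y, if x ≤ y then lam x * kap y * (ε * h x * z y / rankOneMinor h z ε x) else 0 := by
        intro x
        have : lam x * kap x = ∑ y, lam x * ((1 : Matrix (Fin n) (Fin n) K) x y * kap y) := by
          simp [Matrix.one_apply]
        rw [this, ← Finset.sum_add_distrib, Finset.mul_sum]
        refine Finset.sum_congr rfl fun y _ => ?_
        simp only [hV, rankOneUpper, Matrix.add_apply, Matrix.of_apply]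
        split_ifs <;> ring
      rw [Finset.sum_congr rfl fun x _ => e1 x, Finset.sum_add_distrib, horth, zero_add,
        ← Fintype.sum_prod_type', Fintype.sum_eq_add (k, l) (α, l)]
      · simp only [if_pos hkl, if_pos hαl.le, hd1, hzl, show h α = 1 from hhα]
        ring
      · intro he
        exact hαk.ne' (congrArg Prod.fst he)
      · rintro ⟨x, y⟩ ⟨hne1, hne2⟩
        dsimp only
        split_ifs with hxy
        · by_cases hx : x < α
          · rw [show h x = 0 from hh0 x hx]
            simp
          by_cases hy : l < y
          · rw [hz0 y hy]
            simp
          have e2 : lam x * kap y = 0 := by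
            by_contra hne
            have e3 := hmin' x y hxy hne
            have e4 := Fin.le_def.1 (not_lt.1 hx)
            have e5 := Fin.le_def.1 (not_lt.1 hy)
            have e6 := Fin.le_def.1 hxy
            have e7 := Fin.le_def.1 hkl
            rcases (show ((x : ℕ) = k ∧ (y : ℕ) = l) ∨ ((x : ℕ) = α ∧ (y : ℕ) = l) by omega)
              with ⟨h3, h4⟩ | ⟨h3, h4⟩
            · exact hne1 (Prod.ext (Fin.ext h3) (Fin.ext h4))
            · exact hne2 (Prod.ext (Fin.ext h3) (Fin.ext h4))
          rw [e2, zero_mul]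
        · rfl
    have hexp : ((b⁻¹ * (elemGL α l hαl.ne ε)⁻¹).1 * v.1 * (c⁻¹).1) p q
        = (∑ x, lam x * ∑ y, V x y * kap y) - ε * lam α * ∑ y, V l y * kap y := by
      have e1 : ∀ x, (V * (c⁻¹).1) x q = ∑ y, V x y * kap y := fun x => Matrix.mul_apply
      rw [Units.val_mul, hTinv, hvV, Matrix.mul_assoc, Matrix.mul_assoc, sub_mul, one_mul,
        Matrix.mul_sub, Matrix.sub_apply, Matrix.mul_apply, Matrix.mul_apply]
      refine congrArg₂ (· - ·) (Finset.sum_congr rfl fun x _ => by rw [e1]) ?_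
      · rw [Fintype.sum_eq_single α]
        · rw [Matrix.single_mul_apply_same, e1]
          ring
        · intro x hx
          rw [Matrix.single_mul_apply_of_ne _ _ _ _ _ hx, mul_zero]
    rw [hexp, hVxy, hVy] at key
    have hdk := hd k
    have hdl := hd l
    have hkey : ε * kap l * (lam k * h k / rankOneMinor h z ε k
        - ε * (lam α * h l) / rankOneMinor h z ε l) = 0 := by
      rw [← key]
      ring
    have := (mul_eq_zero.1 hkey).resolve_left (mul_ne_zero hε hkapl)
    rwa [sub_eq_zero, div_eq_div_iff hdk hdl] at this
  -- as polynomials in `ε`, the two sides of the relation differ at `ε = 0`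
  let d : ℕ → Polynomial K := fun m =>
    1 + Polynomial.X * Polynomial.C (∑ x : Fin n, if (x : ℕ) < m then h x * z x else 0)
  have hdeval : ∀ ε m, (d m).eval ε = rankOneMinor h z ε m := by
    intro ε m
    simp only [d, rankOneMinor, Polynomial.eval_add, Polynomial.eval_one, Polynomial.eval_mul,
      Polynomial.eval_X, Polynomial.eval_C]
  have hlarge : ∀ ε m, n ≤ m → rankOneMinor h z ε m = rankOneMinor h z ε n := by
    intro ε m hm
    simp only [rankOneMinor]
    congr 2
    refine Finset.sum_congr rfl fun x _ => ?_
    rw [if_pos (x.2.trans_le hm), if_pos x.2]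
  let Q : Polynomial K := Polynomial.C (lam k * h k) * d l
    - Polynomial.X * Polynomial.C (lam α * h l) * d k
  let R : Polynomial K := Polynomial.X * Q * ∏ m ∈ Finset.range (n + 1), d m
  have hR : R = 0 := by
    refine Polynomial.funext fun ε => ?_
    simp only [R, Polynomial.eval_mul, Polynomial.eval_X, Polynomial.eval_zero,
      Polynomial.eval_prod, hdeval]
    by_cases hε : ε = 0
    · rw [hε, zero_mul, zero_mul]
    by_cases hd : ∃ m ∈ Finset.range (n + 1), rankOneMinor h z ε m = 0
    · obtain ⟨m, hm, hm0⟩ := hd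
      rw [Finset.prod_eq_zero hm hm0, mul_zero]
    · push Not at hd
      have hd' : ∀ m, rankOneMinor h z ε m ≠ 0 := by
        intro m
        rcases le_total n m with hm | hm
        · rw [hlarge ε m hm]
          exact hd n (by simp)
        · exact hd m (Finset.mem_range.2 (by omega))
      have hQ : Q.eval ε = 0 := by
        simp only [Q, Polynomial.eval_sub, Polynomial.eval_mul, Polynomial.eval_C,
          Polynomial.eval_X, hdeval]
        rw [hrel ε hε hd', sub_self]
      rw [hQ, mul_zero, zero_mul]
  have hd0 : ∀ m, (d m).eval 0 = 1 := fun m => by rw [hdeval, rankOneMinor, zero_mul, add_zero]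
  have hQ0 : Q ≠ 0 := by
    intro hQ
    have e : Q.eval 0 = lam k * h k := by
      simp [Q, hd0]
    rw [hQ, Polynomial.eval_zero, show h k = -g.1 k α from hhk k hα] at e
    exact mul_ne_zero hlamk (neg_ne_zero.2 hgne) e.symm
  refine mul_ne_zero (mul_ne_zero Polynomial.X_ne_zero hQ0)
    (Finset.prod_ne_zero_iff.2 fun m _ hm => ?_) hR
  have := hd0 m
  rw [hm, Polynomial.eval_zero] at this
  exact zero_ne_one this

end Main

end HomWeyl

end

theorem theorem1 (n : ℕ) (K : Type*) [Field K] [CharZero K] (w : Equiv.Perm (Fin n)) :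
    HomWeyl.IsHomogeneous K w ↔
      ∃ D : Set (Fin n × Fin n), HomWeyl.IsBasic D ∧ w = HomWeyl.wD D := by
  rw [HomWeyl.exists_eq_wD_iff]
  exact ⟨HomWeyl.noBadPair_of_isHomogeneous, HomWeyl.isHomogeneous_of_noBadPair⟩
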